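/- **Setting.** Let $n\ge 1$ be an integer, let $\overline{\mathfrak S}$ be a closed oriented surface (not necessarily connected) and let $\mathfrak S=\overline{\mathfrak S}\setminus\mathcal P$ be a punctured surface with an ideal triangulation $\lambda$ without self-folded triangles. Thus $\overline{\mathfrak S}$ is obtained from a finite set $\mathbb F_\lambda$ of triangles by orientation-reversing identifications of their edges in pairs, the two sides of each edge belonging to different triangles, and $\mathcal P$ is the set of images of the corners. Each face $\tau$ has a characteristic map $f_\tau$ from the triangle with barycentric coordinates $(x_1,x_2,x_3)$, $x_1+x_2+x_3=n$, whose corners are $v_1=(n,0,0)$, $v_2=(0,n,0)$, $v_3=(0,0,n)$ in counterclockwise order. **Quiver.** Let $V_{\mathbb P_3}$ be the set of points $(x_1,x_2,x_3)\in\mathbb Z_{\ge0}^3$ with $x_1+x_2+x_3=n$ other than the corners. For each edge $v_iv_{i+1}$ of the triangle (indices mod 3) there are arrows from $x$ to $y$ in $V_{\mathbb P_3}$ whenever $y$ arises from $x$ by decreasing $x_i$ by $1$ and increasing $x_{i+1}$ by $1$; the arrow has weight $\frac12$ if it lies on the boundary of the triangle and weight $1$ otherwise. Let $V_\lambda=\bigcup_\tau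 f_\tau(V_{\mathbb P_3})$, and let $Q_\lambda\colon V_\lambda\times V_\lambda\to\frac12\mathbb Z$ be the signed weighted adjacency matrix (weight of arrows $v\to v'$ minus weight of arrows $v'\to v$) of the quiver obtained by gluing the quivers of all faces, adding weights. **Balanced vectors.** Let $\mathcal B_{\mathbb P_3}\subset\mathbb Z^{V_{\mathbb P_3}}$ be the subgroup generated by the three coordinate functions and $(n\mathbb Z)^{V_{\mathbb P_3}}$, and let $\mathcal B_\lambda=\{\mathbf k\in\mathbb Z^{V_\lambda}\mid \mathbf k\circ f_\tau\in\mathcal B_{\mathbb P_3}\text{ for all }\tau\in\mathbb F_\lambda\}$. For positive integers $m$ and $M$ put $$\mathcal B_{\lambda,m}=\{\mathbf k\in\mathcal B_\lambda\mid \mathbf kQ_\lambda\mathbf t^T\in mn\mathbb Z\ \ \forall\,\mathbf t\in\mathcal B_\lambda\},\qquad B_{M}=\{\mathbf k\in\mathcal B_\lambda\mid \mathbf kQ_\lambda\mathbf t^T\in M\mathbb Z\ \ \forall\,\mathbf t\in\mathcal B_\lambda\},$$ $$\mathcal B_\lambda^\circ=\{\mathbf k\in\mathcal B_\lambda\mid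 \mathbf kQ_\lambda=0\}.$$ **Algebras.** For $\hat\omega^{1/2}\in\mathbb C^*$ let $\mathcal Z_{\hat\omega}(\mathfrak S,\lambda)$ be the $\mathbb C$-algebra generated by $Z_v^{\pm1}$ $(v\in V_\lambda)$ with relations $Z_vZ_{v'}=\hat\omega^{2Q_\lambda(v,v')}Z_{v'}Z_v$. For $\mathbf k\in\mathbb Z^{V_\lambda}$ and any enumeration $v_1,\dots,v_r$ of $V_\lambda$ let $Z^{\mathbf k}=\hat\omega^{-\sum_{i<j}k_{v_i}k_{v_j}Q_\lambda(v_i,v_j)}Z_{v_1}^{k_{v_1}}\cdots Z_{v_r}^{k_{v_r}}$ (it does not depend on the enumeration). The balanced Fock–Goncharov algebra is the subalgebra $\mathcal Z^{\rm bl}_{\hat\omega}(\mathfrak S,\lambda)=\operatorname{span}_{\mathbb C}\{Z^{\mathbf k}\mid\mathbf k\in\mathcal B_\lambda\}$. **Puncture vectors.** For $p\in\mathcal P$ and $1\le i\le n-1$ let $\mathbf a(\lambda,p,i)\in\mathbb Z^{V_\lambda}$ be the vector whose value at $f_\tau(x)$ is the number of $j\in\{1,2,3\}$ with $f_\tau(v_j)=p$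 and $x_j=n-i$ (this is well defined), and let $$\mathbf b(\lambda,p,i)=\sum_{1\le t\le n-i-1}n(t+i-n)\,\mathbf a(\lambda,p,t)+(n-i)\sum_{1\le t\le n-1}(n-t)\,\mathbf a(\lambda,p,t)\in\mathcal B_\lambda .$$ **Root of unity assumption.** Let $\hat\omega^{1/2}\in\mathbb C$ be a root of unity, let $N''$ be the order of $\hat\omega^2$, and put $N'=N''/\gcd(N'',n)$, $d=\gcd(N',n)$, $N=N'/d$ and $\hat\eta^{1/2}=(\hat\omega^{1/2})^{N^2}$. Let $\Phi^{\mathbb T}\colon\mathcal Z^{\rm bl}_{\hat\eta}(\mathfrak S,\lambda)\to\mathcal Z^{\rm bl}_{\hat\omega}(\mathfrak S,\lambda)$ be the algebra homomorphism with $\Phi^{\mathbb T}(Z^{\mathbf k})=Z^{N\mathbf k}$ for $\mathbf k\in\mathcal B_\lambda$. **Theorem.** The center of $\mathcal Z^{\rm bl}_{\hat\omega}(\mathfrak S,\lambda)$ is, as a $\mathbb C$-subalgebra of $\mathcal Z^{\rm bl}_{\hat\omega}(\mathfrak S,\lambda)$, generated by $$\{\Phi^{\mathbb T}(Z^{\mathbf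 k})\mid\mathbf k\in\mathcal B_{\lambda,d}\}\ \cup\ \{Z^{\mathbf b(\lambda,p,i)}\mid p\in\mathcal P,\ 1\le i\le n-1\}.$$ Moreover $B_{N''}=N\mathcal B_{\lambda,d}+\mathcal B_\lambda^\circ$. -/

import Mathlib

open scoped BigOperators

noncomputable section

/-! ## Quantum tori

Throughout, `A = 2 Q` is the doubled (integral) matrix of an anti-symmetric half-integral matrix `Q`,
and `h` is a fixed square root of the quantum parameter `q`, so that `q ^ (2 Q(v,w)) = h ^ (2 A v w)`
and `q ^ (Q(v,w)) = h ^ (A v w)`. -/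

/-- The defining relations of the quantum torus, on the free algebra over letters
`Sum.inl v` (standing for `Z_v`) and `Sum.inr v` (standing for `Z_v⁻¹`). -/
inductive QTorusRel {V : Type*} (A : V → V → ℤ) (h : ℂˣ) :
    FreeAlgebra ℂ (V ⊕ V) → FreeAlgebra ℂ (V ⊕ V) → Prop
  | mul_inv (v : V) :
      QTorusRel A h (FreeAlgebra.ι ℂ (Sum.inl v) * FreeAlgebra.ι ℂ (Sum.inr v)) 1
  | inv_mul (v : V) :
      QTorusRel A h (FreeAlgebra.ι ℂ (Sum.inr v) * FreeAlgebra.ι ℂ (Sum.inl v)) 1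
  | comm (v w : V) :
      QTorusRel A h (FreeAlgebra.ι ℂ (Sum.inl v) * FreeAlgebra.ι ℂ (Sum.inl w))
        (((h ^ (2 * A v w) : ℂˣ) : ℂ) •
          (FreeAlgebra.ι ℂ (Sum.inl w) * FreeAlgebra.ι ℂ (Sum.inl v)))

/-- The quantum torus `ℂ⟨Z_v^{±1}⟩ / (Z_v Z_w = q^{2 Q(v,w)} Z_w Z_v)`, `A = 2 Q`, `q = h ^ 2`. -/
abbrev QTorus {V : Type*} (A : V → V → ℤ) (h : ℂˣ) : Type _ := RingQuot (QTorusRel A h)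

namespace QTorus

variable {V : Type*} (A : V → V → ℤ) (h : ℂˣ)

/-- The image of a letter in the quantum torus. -/
def letter (s : V ⊕ V) : QTorus A h :=
  RingQuot.mkAlgHom ℂ (QTorusRel A h) (FreeAlgebra.ι ℂ s)

theorem letter_mul_inv (v : V) : letter A h (Sum.inl v) * letter A h (Sum.inr v) = 1 := by
  have := RingQuot.mkAlgHom_rel ℂ (QTorusRel.mul_inv (A := A) (h := h) v)
  simpa [letter] using this

theorem letter_inv_mul (v : V) : letter A h (Sum.inr v) * letter A h (Sum.inl v) = 1 := by
  have := RingQuot.mkAlgHom_rel ℂ (QTorusRel.inv_mul (A := A) (h := h) v)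
  simpa [letter] using this

/-- The generator `Z_v`, as an invertible element. -/
def gen (v : V) : (QTorus A h)ˣ where
  val := letter A h (Sum.inl v)
  inv := letter A h (Sum.inr v)
  val_inv := letter_mul_inv A h v
  inv_val := letter_inv_mul A h v

/-- Nonzero scalars as invertible elements. -/
def scalar : ℂˣ →* (QTorus A h)ˣ := Units.map (algebraMap ℂ (QTorus A h)).toMonoidHom

theorem scalar_comm (c : ℂˣ) (x : (QTorus A h)ˣ) : scalar A h c * x = x * scalar A h c := by
  ext
  exact Algebra.commutes (c : ℂ) (x : QTorus A h)

theorem gen_mul_gen (v w : V) :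
    gen A h v * gen A h w = scalar A h (h ^ (2 * A v w)) * (gen A h w * gen A h v) := by
  ext
  have := RingQuot.mkAlgHom_rel ℂ (QTorusRel.comm (A := A) (h := h) v w)
  rw [map_mul, map_smul, map_mul, Algebra.smul_def] at this
  exact this

/-- The product `Z_{v₁}^{a₁} ⋯ Z_{v_r}^{a_r}` of a list `[(v₁, a₁), …, (v_r, a_r)]`. -/
def listProd (l : List (V × ℤ)) : (QTorus A h)ˣ := (l.map fun p => gen A h p.1 ^ p.2).prod

/-- `∑_{i<j} a_i a_j A(v_i, v_j)`. -/
def weylExponent : List (V × ℤ) → ℤ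
  | [] => 0
  | p :: l => (l.map fun r => p.2 * r.2 * A p.1 r.1).sum + weylExponent l

/-- The Weyl-ordered product
`[Z_{v₁}^{a₁} ⋯ Z_{v_r}^{a_r}] = q^{-∑_{i<j} a_i a_j Q(v_i,v_j)} Z_{v₁}^{a₁} ⋯ Z_{v_r}^{a_r}`. -/
def weyl (l : List (V × ℤ)) : QTorus A h :=
  ((h ^ (-weylExponent A l) : ℂˣ) : ℂ) • (listProd A h l : QTorus A h)

/-- The monomial `Z^k`: the Weyl-ordered product of all `Z_v ^ (k v)`. The product is taken along an
enumeration of `V`; as `A` is anti-symmetric in all uses, it does not depend on the enumeration. -/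
def monomial [Fintype V] (k : V → ℤ) : QTorus A h :=
  weyl A h (Finset.univ.toList.map fun v => (v, k v))

theorem monomial_zero [Fintype V] : monomial A h (0 : V → ℤ) = 1 := by
  have h1 : ∀ l : List V, weylExponent A (l.map fun v => (v, (0 : V → ℤ) v)) = 0 := by
    intro l
    induction l with
    | nil => rfl
    | cons a l ih => simpa [weylExponent, Function.comp_def] using ih
  simp only [monomial, weyl, h1, listProd]
  simp [Function.comp_def]

theorem group_list_prod_mul {G : Type*} [Group G] (g : V → G)
    (hg : ∀ v w, Commute (g v) (g w)) (k t : V → ℤ) (l : List V) :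
    (l.map fun v => g v ^ k v).prod * (l.map fun v => g v ^ t v).prod
      = (l.map fun v => g v ^ (k v + t v)).prod := by
  induction l with
  | nil => simp
  | cons a l ih =>
    simp only [List.map_cons, List.prod_cons, ← ih]
    have hc : Commute (l.map fun v => g v ^ k v).prod (g a ^ t a) := by
      apply Commute.list_prod_left
      intro x hx
      obtain ⟨v, -, rfl⟩ := List.mem_map.1 hx
      exact (hg v a).zpow_zpow _ _
    rw [zpow_add, mul_assoc, ← mul_assoc _ (g a ^ t a), hc.eq]
    simp only [mul_assoc]

theorem exists_listProd_mul (k t : V → ℤ) (l : List V) :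
    ∃ c : ℂˣ, listProd A h (l.map fun v => (v, k v)) * listProd A h (l.map fun v => (v, t v))
      = scalar A h c * listProd A h (l.map fun v => (v, (k + t) v)) := by
  let C : Subgroup (QTorus A h)ˣ := (scalar A h).range
  have : C.Normal := ⟨by
    rintro _ ⟨c, rfl⟩ g
    refine ⟨c, ?_⟩
    rw [← scalar_comm, mul_assoc, mul_inv_cancel, mul_one]⟩
  let π : (QTorus A h)ˣ →* (QTorus A h)ˣ ⧸ C := QuotientGroup.mk' C
  have hπ : ∀ v w, Commute (π (gen A h v)) (π (gen A h w)) := by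
    intro v w
    have h1 : π (scalar A h (h ^ (2 * A v w))) = 1 :=
      (QuotientGroup.eq_one_iff _).2 ⟨_, rfl⟩
    show π _ * π _ = π _ * π _
    rw [← map_mul, gen_mul_gen, map_mul, h1, one_mul, map_mul]
  have hl : ∀ m : V → ℤ, π (listProd A h (l.map fun v => (v, m v)))
      = (l.map fun v => π (gen A h v) ^ m v).prod := by
    intro m
    simp only [listProd, map_list_prod, List.map_map, Function.comp_def, map_zpow]
  have key : π (listProd A h (l.map fun v => (v, (k + t) v)))
      = π (listProd A h (l.map fun v => (v, k v)) * listProd A h (l.map fun v => (v, t v))) := by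
    rw [map_mul, hl, hl, hl, group_list_prod_mul _ hπ]
    rfl
  obtain ⟨c, hc⟩ := QuotientGroup.eq.1 key
  refine ⟨c, ?_⟩
  rw [scalar_comm, hc, mul_inv_cancel_left]

theorem exists_monomial_mul [Fintype V] (k t : V → ℤ) :
    ∃ c : ℂ, monomial A h k * monomial A h t = c • monomial A h (k + t) := by
  obtain ⟨c, hc⟩ := exists_listProd_mul A h k t Finset.univ.toList
  have hc' := congrArg Units.val hc
  rw [Units.val_mul, Units.val_mul] at hc'
  have hs : ((scalar A h c : (QTorus A h)ˣ) : QTorus A h) = algebraMap ℂ _ (c : ℂ) := rfl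
  rw [hs, ← Algebra.smul_def] at hc'
  simp only [monomial, weyl]
  rw [smul_mul_smul_comm, hc']
  refine ⟨(h ^ (-weylExponent A (Finset.univ.toList.map fun v => (v, k v))) : ℂˣ) *
    (h ^ (-weylExponent A (Finset.univ.toList.map fun v => (v, t v))) : ℂˣ) * c *
    (h ^ (weylExponent A (Finset.univ.toList.map fun v => (v, (k + t) v))) : ℂˣ), ?_⟩
  rw [smul_smul, smul_smul]
  congr 1
  rw [mul_assoc (_ * _ * (c : ℂ)), zpow_neg h (weylExponent A (Finset.univ.toList.map
    fun v => (v, (k + t) v))), Units.mul_inv, mul_one]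

/-- The monomial subalgebra `span_ℂ {Z^k | k ∈ Λ}` of the quantum torus. -/
def monomialSubalgebra [Fintype V] (Λ : AddSubgroup (V → ℤ)) : Subalgebra ℂ (QTorus A h) :=
  Submodule.toSubalgebra (Submodule.span ℂ (monomial A h '' (Λ : Set (V → ℤ))))
    (Submodule.subset_span ⟨0, Λ.zero_mem, monomial_zero A h⟩)
    (by
      intro x y hx hy
      induction hx using Submodule.span_induction with
      | zero => simp
      | add x x' _ _ h1 h2 => rw [add_mul]; exact Submodule.add_mem _ h1 h2
      | smul c x _ h1 => rw [smul_mul_assoc]; exact Submodule.smul_mem _ _ h1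
      | mem x hx =>
        obtain ⟨k, hk, rfl⟩ := hx
        induction hy using Submodule.span_induction with
        | zero => simp
        | add y y' _ _ h1 h2 => rw [mul_add]; exact Submodule.add_mem _ h1 h2
        | smul c y _ h1 => rw [mul_smul_comm]; exact Submodule.smul_mem _ _ h1
        | mem y hy =>
          obtain ⟨t, ht, rfl⟩ := hy
          obtain ⟨c, hc⟩ := exists_monomial_mul A h k t
          rw [hc]
          exact Submodule.smul_mem _ _ (Submodule.subset_span ⟨_, Λ.add_mem hk ht, rfl⟩))

/-- The monomial `Z^k`, `k ∈ Λ`, as an element of the monomial subalgebra of `Λ`. -/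
def mono [Fintype V] (Λ : AddSubgroup (V → ℤ)) (k : Λ) : monomialSubalgebra A h Λ :=
  ⟨monomial A h k, Submodule.subset_span ⟨k, k.2, rfl⟩⟩

/-! ### The Frobenius map -/

theorem gen_pow_mul_gen_pow (N : ℕ) (v w : V) :
    gen A h v ^ N * gen A h w ^ N
      = scalar A h ((h ^ (N ^ 2)) ^ (2 * A v w)) * (gen A h w ^ N * gen A h v ^ N) := by
  have h1 : ∀ (c : ℂˣ) (x y : (QTorus A h)ˣ), x * y = scalar A h c * (y * x) →
      ∀ m : ℕ, x ^ m * y = scalar A h (c ^ m) * (y * x ^ m) := by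
    intro c x y hxy m
    induction m with
    | zero => simp
    | succ m ih =>
      rw [pow_succ, mul_assoc, hxy, ← mul_assoc, ← scalar_comm, mul_assoc, ← mul_assoc _ y, ih,
        pow_succ, map_mul, scalar_comm A h (c ^ m) (scalar A h c)]
      simp only [mul_assoc]
  have h2 : ∀ (c : ℂˣ) (x y : (QTorus A h)ˣ), x * y = scalar A h c * (y * x) →
      y * x = scalar A h c⁻¹ * (x * y) := by
    intro c x y hxy
    rw [hxy, map_inv, inv_mul_cancel_left]
  have h3 := h1 _ _ _ (gen_mul_gen A h v w) N
  have h4 := h2 _ _ _ (h1 _ _ _ (h2 _ _ _ h3) N)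
  rw [h4, inv_pow, inv_inv]
  congr 2
  rw [← pow_mul, ← zpow_natCast, ← zpow_natCast, ← zpow_mul, ← zpow_mul]
  congr 1
  push_cast
  ring

/-- The algebra map `Z_v ↦ Z_v ^ N` from the quantum torus with parameter `h ^ (N ^ 2)` (the square
root of `q ^ (N ^ 2)`) to the one with parameter `h`. -/
def frobenius (N : ℕ) : QTorus A (h ^ (N ^ 2)) →ₐ[ℂ] QTorus A h :=
  RingQuot.liftAlgHom ℂ
    ⟨FreeAlgebra.lift ℂ (Sum.elim (fun v => ((gen A h v ^ N : (QTorus A h)ˣ) : QTorus A h))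
      (fun v => (((gen A h v ^ N)⁻¹ : (QTorus A h)ˣ) : QTorus A h))), by
      intro x y hxy
      induction hxy with
      | mul_inv v =>
        simp only [map_mul, FreeAlgebra.lift_ι_apply, Sum.elim_inl, Sum.elim_inr, map_one,
          Units.mul_inv]
      | inv_mul v =>
        simp only [map_mul, FreeAlgebra.lift_ι_apply, Sum.elim_inl, Sum.elim_inr, map_one,
          Units.inv_mul]
      | comm v w =>
        have := congrArg Units.val (gen_pow_mul_gen_pow A h N v w)
        simp only [map_mul, map_smul, FreeAlgebra.lift_ι_apply, Sum.elim_inl]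
        rw [Algebra.smul_def]
        exact this⟩

theorem frobenius_gen (N : ℕ) (v : V) :
    Units.map (frobenius A h N).toMonoidHom (gen A (h ^ (N ^ 2)) v) = gen A h v ^ N := by
  ext
  show frobenius A h N (RingQuot.mkAlgHom ℂ _ (FreeAlgebra.ι ℂ (Sum.inl v))) = _
  rw [frobenius, RingQuot.liftAlgHom_mkAlgHom_apply, FreeAlgebra.lift_ι_apply]
  rfl

theorem frobenius_monomial [Fintype V] (N : ℕ) (k : V → ℤ) :
    frobenius A h N (monomial A (h ^ (N ^ 2)) k) = monomial A h (N • k) := by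
  have h1 : ∀ l : List V, weylExponent A (l.map fun v => (v, (N • k) v))
      = (N : ℤ) ^ 2 * weylExponent A (l.map fun v => (v, k v)) := by
    intro l
    induction l with
    | nil => simp [weylExponent]
    | cons a l ih =>
      simp only [List.map_cons, weylExponent, ih, mul_add, List.map_map, Function.comp_def,
        ← List.sum_map_mul_left]
      congr 3
      funext v
      simp only [Pi.smul_apply, nsmul_eq_mul]
      ring
  have h2 : ∀ l : List V, Units.map (frobenius A h N).toMonoidHom
      (listProd A (h ^ (N ^ 2)) (l.map fun v => (v, k v)))
        = listProd A h (l.map fun v => (v, (N • k) v)) := by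
    intro l
    simp only [listProd, map_list_prod, List.map_map, Function.comp_def, map_zpow, frobenius_gen]
    congr 2
    funext v
    rw [← zpow_natCast, ← zpow_mul]
    simp
  simp only [monomial, weyl, map_smul]
  have h3 := congrArg Units.val (h2 Finset.univ.toList)
  rw [Units.coe_map] at h3
  have h4 : frobenius A h N (listProd A (h ^ (N ^ 2)) (Finset.univ.toList.map fun v => (v, k v)))
      = listProd A h (Finset.univ.toList.map fun v => (v, (N • k) v)) := h3
  rw [h4, h1]
  congr 2
  rw [← zpow_natCast, ← zpow_mul]
  push_cast
  congr 1
  ring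

/-- The Frobenius map between monomial subalgebras, `Z^k ↦ Z^{N k}` for `k ∈ Λ`. -/
def frobeniusMono [Fintype V] (Λ : AddSubgroup (V → ℤ)) (N : ℕ) :
    monomialSubalgebra A (h ^ (N ^ 2)) Λ →ₐ[ℂ] monomialSubalgebra A h Λ :=
  ((frobenius A h N).comp (monomialSubalgebra A (h ^ (N ^ 2)) Λ).val).codRestrict
    (monomialSubalgebra A h Λ) (by
      rintro ⟨x, hx⟩
      show frobenius A h N x ∈ Submodule.span ℂ (monomial A h '' (Λ : Set (V → ℤ)))
      change x ∈ Submodule.span ℂ (monomial A (h ^ (N ^ 2)) '' (Λ : Set (V → ℤ))) at hx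
      induction hx using Submodule.span_induction with
      | zero => simp
      | add x y _ _ h1 h2 => rw [map_add]; exact Submodule.add_mem _ h1 h2
      | smul c x _ h1 => rw [map_smul]; exact Submodule.smul_mem _ _ h1
      | mem x hx =>
        obtain ⟨k, hk, rfl⟩ := hx
        rw [frobenius_monomial]
        exact Submodule.subset_span ⟨_, Λ.nsmul_mem hk N, rfl⟩)

theorem frobeniusMono_mono [Fintype V] (Λ : AddSubgroup (V → ℤ)) (N : ℕ) (k : Λ) :
    frobeniusMono A h Λ N (mono A (h ^ (N ^ 2)) Λ k) = mono A h Λ (N • k) :=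
  Subtype.ext (frobenius_monomial A h N k)

end QTorus

/-! ## Triangulated punctured surfaces -/

/-- The standard triangle in barycentric coordinates; with its three corners removed it is the ideal
triangle. The corners `0, 1, 2` are in counterclockwise order and edge `i` joins corner `i` to corner
`i + 1`, so that edge `i` is the locus where coordinate `i + 2` vanishes. -/
abbrev Triangle : Type := stdSimplex ℝ (Fin 3)

/-- Corner `c` of the triangle. -/
def Triangle.corner (c : Fin 3) : Triangle := ⟨Pi.single c 1, single_mem_stdSimplex ℝ c⟩

/-- The orientation-reversing identification of edge `i` of a copy `τ` of the triangle with edge `j`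
of a copy `τ'`, whenever `glue (τ, i) = (τ', j)`: the point of edge `i` with coordinates `(s, 1 - s)`
at the corners `i, i + 1` is identified with the point of edge `j` with coordinates `(1 - s, s)` at
the corners `j, j + 1`. -/
def EdgeGlued {F : Type*} (glue : F × Fin 3 → F × Fin 3) (a b : F × Triangle) : Prop :=
  ∃ i j : Fin 3, glue (a.1, i) = (b.1, j) ∧
    a.2.1 (i + 2) = 0 ∧ b.2.1 (j + 2) = 0 ∧
    b.2.1 (j + 1) = a.2.1 i ∧ b.2.1 j = a.2.1 (i + 1)

/-- An (ideal) triangulation, with set of faces `F` and without self-folded triangles, of a punctured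
surface. Here `S` is the closed oriented surface with the punctures filled in: it is the quotient of
finitely many copies of the triangle under orientation-reversing identifications of their edges in
pairs. The punctures are the images of the corners, the ideal arcs are the images of the edges.
`S` is not assumed connected. -/
structure IdealTriangulation (S : Type*) [TopologicalSpace S] (F : Type*) [Fintype F] where
  /-- the pairing of the edges of the faces -/
  glue : F × Fin 3 → F × Fin 3
  glue_glue : ∀ a, glue (glue a) = a
  /-- each ideal arc is adjacent to two different faces -/
  glue_fst_ne : ∀ a, (glue a).1 ≠ a.1
  /-- the characteristic map of a face -/
  char : F → Triangle → S
  isQuotientMap_char : Topology.IsQuotientMap (fun a : Σ _ : F, Triangle => char a.1 a.2)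
  char_eq_char_iff : ∀ (τ τ' : F) (x y : Triangle),
    char τ x = char τ' y ↔ Relation.EqvGen (EdgeGlued glue) (τ, x) (τ', y)

/-- The small vertices of the `n`-triangulation of an ideal triangle: the points with integral
barycentric coordinates of sum `n`, apart from the three corners. -/
abbrev TriVertex (n : ℕ) : Type := {x : Fin 3 → ℕ // ∑ c, x c = n ∧ ∀ c, x c ≠ n}

namespace TriVertex

variable {n : ℕ}

instance : Finite (TriVertex n) := by
  apply Set.Finite.subset (Set.finite_Iic (fun _ : Fin 3 => n))
  rintro x ⟨hx, -⟩ c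
  show x c ≤ n
  rw [← hx]
  exact Finset.single_le_sum (f := x) (fun _ _ => Nat.zero_le _) (Finset.mem_univ c)

instance : Fintype (TriVertex n) := Fintype.ofFinite _

theorem n_ne_zero (x : TriVertex n) : n ≠ 0 := by
  rintro rfl
  have h := x.2.1
  exact x.2.2 0 (Finset.sum_eq_zero_iff.1 h 0 (Finset.mem_univ _))

/-- The position of a small vertex in the triangle. -/
def toTriangle (x : TriVertex n) : Triangle :=
  ⟨fun c => (x.1 c : ℝ) / n, fun c => by positivity, by
    have h0 : (n : ℝ) ≠ 0 := Nat.cast_ne_zero.2 x.n_ne_zero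
    rw [← Finset.sum_div, ← Nat.cast_sum, x.2.1, div_self h0]⟩

open Classical in
/-- Twice the weight of the arrow from `x` to `y` in the quiver of the ideal triangle. Arrows parallel
to edge `i` point from corner `i` to corner `i + 1`; they have weight `1/2` on the boundary of the
triangle and weight `1` in the interior. -/
def doubledArrow (x y : TriVertex n) : ℤ :=
  ∑ i : Fin 3,
    if y.1 i + 1 = x.1 i ∧ y.1 (i + 1) = x.1 (i + 1) + 1 ∧ y.1 (i + 2) = x.1 (i + 2) then
      (if x.1 (i + 2) = 0 then 1 else 2)
    else 0

/-- Twice the signed adjacency matrix of the quiver of the ideal triangle. -/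
def doubledQ (x y : TriVertex n) : ℤ := doubledArrow x y - doubledArrow y x

end TriVertex

/-- The balanced vectors of the ideal triangle: the subgroup generated by the three barycentric
coordinate functions and the vectors all of whose entries are divisible by `n`. -/
def balancedTriangle (n : ℕ) : AddSubgroup (TriVertex n → ℤ) :=
  AddSubgroup.closure
    (Set.range (fun (c : Fin 3) (x : TriVertex n) => (x.1 c : ℤ)) ∪
      {k | ∀ x, (n : ℤ) ∣ k x})

namespace IdealTriangulation

variable {S : Type*} [TopologicalSpace S] {F : Type*} [Fintype F] (T : IdealTriangulation S F)
  (n : ℕ)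

/-- The set of punctures. -/
def punctures : Set S := Set.range fun a : F × Fin 3 => T.char a.1 (Triangle.corner a.2)

/-- The set `V_λ` of small vertices of the `n`-triangulation, as points of the surface. -/
def SmallVertex : Type _ := Set.range fun a : F × TriVertex n => T.char a.1 a.2.toTriangle

instance : Finite (T.SmallVertex n) := Set.finite_range _

instance : Fintype (T.SmallVertex n) := Fintype.ofFinite _

/-- The characteristic map of the face `τ` on small vertices. -/
def vert (τ : F) (x : TriVertex n) : T.SmallVertex n := ⟨_, ⟨(τ, x), rfl⟩⟩

open Classical in
/-- Twice the signed adjacency matrix `Q_λ` of the quiver on the surface glued from the quivers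
of the faces: weights of arrows with the same image are added, opposite arrows cancel. -/
def doubledQ (u v : T.SmallVertex n) : ℤ :=
  ∑ τ : F, ∑ x : TriVertex n, ∑ y : TriVertex n,
    if T.vert n τ x = u ∧ T.vert n τ y = v then TriVertex.doubledQ x y else 0

/-- `2 k Q_λ tᵀ`. -/
def doubledForm (k t : T.SmallVertex n → ℤ) : ℤ := ∑ u, ∑ v, k u * T.doubledQ n u v * t v

/-- The group `B_λ` of balanced vectors: those whose pullback to every face is balanced. -/
def balanced : AddSubgroup (T.SmallVertex n → ℤ) where
  carrier := {k | ∀ τ : F, (fun x => k (T.vert n τ x)) ∈ balancedTriangle n}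
  zero_mem' := fun _ => (balancedTriangle n).zero_mem
  add_mem' := fun h1 h2 τ => (balancedTriangle n).add_mem (h1 τ) (h2 τ)
  neg_mem' := fun h1 τ => (balancedTriangle n).neg_mem (h1 τ)

/-- `{k ∈ B_λ | k Q_λ tᵀ ∈ M ℤ for all t ∈ B_λ}`. -/
def balancedModKernel (M : ℕ) : AddSubgroup (T.SmallVertex n → ℤ) where
  carrier := {k | k ∈ T.balanced n ∧ ∀ t ∈ T.balanced n, (2 * M : ℤ) ∣ T.doubledForm n k t}
  zero_mem' := ⟨(T.balanced n).zero_mem, fun t _ => by simp [doubledForm]⟩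
  add_mem' := fun {k l} h1 h2 => ⟨(T.balanced n).add_mem h1.1 h2.1, fun t ht => by
    have : T.doubledForm n (k + l) t = T.doubledForm n k t + T.doubledForm n l t := by
      simp only [doubledForm, Pi.add_apply, add_mul, Finset.sum_add_distrib]
    rw [this]
    exact dvd_add (h1.2 t ht) (h2.2 t ht)⟩
  neg_mem' := fun {k} h1 => ⟨(T.balanced n).neg_mem h1.1, fun t ht => by
    have : T.doubledForm n (-k) t = -T.doubledForm n k t := by
      simp only [doubledForm, Pi.neg_apply, neg_mul, Finset.sum_neg_distrib]
    rw [this]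
    exact (dvd_neg).2 (h1.2 t ht)⟩

/-- `B_{λ,m} = {k ∈ B_λ | k Q_λ tᵀ = 0 in ℤ / (m n) for all t ∈ B_λ}`. -/
def balancedMod (m : ℕ) : AddSubgroup (T.SmallVertex n → ℤ) := T.balancedModKernel n (m * n)

/-- `B_λ° = {k ∈ B_λ | k Q_λ = 0}`. -/
def balancedRadical : AddSubgroup (T.SmallVertex n → ℤ) where
  carrier := {k | k ∈ T.balanced n ∧ ∀ v, ∑ u, k u * T.doubledQ n u v = 0}
  zero_mem' := ⟨(T.balanced n).zero_mem, fun v => by simp⟩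
  add_mem' := fun h1 h2 => ⟨(T.balanced n).add_mem h1.1 h2.1, fun v => by
    simp only [Pi.add_apply, add_mul, Finset.sum_add_distrib, h1.2 v, h2.2 v, add_zero]⟩
  neg_mem' := fun h1 => ⟨(T.balanced n).neg_mem h1.1, fun v => by
    simp only [Pi.neg_apply, neg_mul, Finset.sum_neg_distrib, h1.2 v, neg_zero]⟩

/-- The balanced Fock-Goncharov algebra `span_ℂ {Z^k | k ∈ B_λ}` inside the quantum torus of `Q_λ`;
the quantum parameter is `h ^ 2`. -/
abbrev balancedAlgebra (h : ℂˣ) : Subalgebra ℂ (QTorus (T.doubledQ n) h) :=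
  QTorus.monomialSubalgebra (T.doubledQ n) h (T.balanced n)

/-- The monomial `Z^k`, `k ∈ B_λ`, in the balanced Fock-Goncharov algebra. -/
abbrev Z (h : ℂˣ) (k : T.balanced n) : T.balancedAlgebra n h :=
  QTorus.mono (T.doubledQ n) h (T.balanced n) k

/-- The Frobenius map `Z^k ↦ Z^{N k}` of balanced Fock-Goncharov algebras, from parameter
`(h ^ (N ^ 2)) ^ 2` to parameter `h ^ 2`. -/
abbrev Φ (h : ℂˣ) (N : ℕ) : T.balancedAlgebra n (h ^ (N ^ 2)) →ₐ[ℂ] T.balancedAlgebra n h :=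
  QTorus.frobeniusMono (T.doubledQ n) h (T.balanced n) N

open Classical in
/-- The entry at the small vertex `x` of the face `τ` of the sum of the vectors `a(τ, c, i)` over the
corners `c` of `τ` that lie at `p`: here `a(τ, c, i)` is the indicator function of the small vertices
whose barycentric coordinate at `c` is `n - i`. -/
def faceA (p : S) (i : ℕ) (τ : F) (x : TriVertex n) : ℤ :=
  ∑ c : Fin 3, if T.char τ (Triangle.corner c) = p ∧ x.1 c + i = n then 1 else 0

/-- The vector `a(λ, p, i)`, glued from the vectors `a(τ, c, i)` (see `a_vert`). -/
def a (p : S) (i : ℕ) (v : T.SmallVertex n) : ℤ :=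
  T.faceA n p i v.2.choose.1 v.2.choose.2

/-- The vector `b(λ, p, i)`, for `1 ≤ i ≤ n - 1`. -/
def b (p : S) (i : ℕ) : T.SmallVertex n → ℤ :=
  ∑ t ∈ Finset.Icc 1 (n - i - 1), ((n : ℤ) * (t + i - n)) • T.a n p t
    + ((n : ℤ) - i) • ∑ t ∈ Finset.Icc 1 (n - 1), ((n : ℤ) - t) • T.a n p t

theorem char_corner_eq {τ τ' : F} {i j : Fin 3} (hg : T.glue (τ, i) = (τ', j)) :
    T.char τ (Triangle.corner i) = T.char τ' (Triangle.corner (j + 1)) ∧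
      T.char τ (Triangle.corner (i + 1)) = T.char τ' (Triangle.corner j) := by
  constructor
  · rw [T.char_eq_char_iff]
    refine Relation.EqvGen.rel _ _ ⟨i, j, hg, ?_⟩
    clear hg
    fin_cases i <;> fin_cases j <;> simp [Triangle.corner]
  · rw [T.char_eq_char_iff]
    refine Relation.EqvGen.rel _ _ ⟨i, j, hg, ?_⟩
    clear hg
    fin_cases i <;> fin_cases j <;> simp [Triangle.corner]

/-- The vectors `a(τ, c, i)` on the faces are compatible with the gluing. -/
theorem faceA_eq {p : S} {i : ℕ} (hi : i < n) {τ τ' : F} {x x' : TriVertex n}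
    (hx : T.vert n τ x = T.vert n τ' x') : T.faceA n p i τ x = T.faceA n p i τ' x' := by
  classical
  have hn : (n : ℝ) ≠ 0 := Nat.cast_ne_zero.2 x.n_ne_zero
  -- the same count for arbitrary points of the faces
  let G : F × Triangle → ℤ := fun a =>
    ∑ c : Fin 3, if T.char a.1 (Triangle.corner c) = p ∧ a.2.1 c * n + i = n then 1 else 0
  have hG : ∀ (τ : F) (x : TriVertex n), T.faceA n p i τ x = G (τ, x.toTriangle) := by
    intro τ x
    simp only [faceA, G, TriVertex.toTriangle]
    refine Finset.sum_congr rfl fun c _ => ?_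
    rw [div_mul_cancel₀ _ hn]
    norm_cast
  have hin : ¬ ((0 : ℝ) * n + i = n) := by
    rw [zero_mul, zero_add]
    exact_mod_cast hi.ne
  have hrel : ∀ a b : F × Triangle, EdgeGlued T.glue a b → G a = G b := by
    rintro ⟨τ, x⟩ ⟨τ', y⟩ ⟨j, k, hg, hx0, hy0, h1, h2⟩
    obtain ⟨c1, c2⟩ := T.char_corner_eq hg
    have hsum : ∀ (j : Fin 3) (f : Fin 3 → ℤ), ∑ c, f c = f j + f (j + 1) + f (j + 2) := by
      intro j f
      rw [Fin.sum_univ_three]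
      fin_cases j <;> simp <;> ring
    simp only [G]
    rw [hsum j, hsum k]
    dsimp only at hx0 hy0 h1 h2
    dsimp only at c1 c2
    rw [hx0, hy0, h1, h2, c1, c2, if_neg (fun h : T.char τ (Triangle.corner (j + 2)) = p ∧ _ =>
      hin h.2), if_neg (fun h : T.char τ' (Triangle.corner (k + 2)) = p ∧ _ => hin h.2)]
    ring
  have hE : Relation.EqvGen (EdgeGlued T.glue) (τ, x.toTriangle) (τ', x'.toTriangle) :=
    (T.char_eq_char_iff _ _ _ _).1 (congrArg Subtype.val hx)
  rw [hG, hG]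
  generalize (τ, x.toTriangle) = a at hE ⊢
  generalize (τ', x'.toTriangle) = b at hE ⊢
  induction hE with
  | rel a b h => exact hrel a b h
  | refl a => rfl
  | symm a b _ ih => exact ih.symm
  | trans a b c _ _ ih1 ih2 => exact ih1.trans ih2

/-- The pullback of `a(λ, p, i)` to a face `τ` is the sum of the vectors `a(τ, c, i)` over the corners
`c` of `τ` at `p`. -/
theorem a_vert (p : S) {i : ℕ} (hi : i < n) (τ : F) (x : TriVertex n) :
    T.a n p i (T.vert n τ x) = T.faceA n p i τ x := by
  apply T.faceA_eq n hi
  exact Subtype.ext (T.vert n τ x).2.choose_spec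

theorem b_mem (p : S) (i : ℕ) : T.b n p i ∈ T.balanced n := by
  classical
  intro τ
  rcases Nat.eq_zero_or_pos n with h0 | hpos
  · have : (fun x => T.b n p i (T.vert n τ x)) = 0 := by
      funext x
      exact absurd h0 x.n_ne_zero
    rw [this]
    exact AddSubgroup.zero_mem _
  have hk : ∀ x : TriVertex n, ∀ c : Fin 3,
      ∑ t ∈ Finset.Icc 1 (n - 1), ((n : ℤ) - t) * (if x.1 c + t = n then 1 else 0) = x.1 c := by
    intro x c
    have hle : x.1 c ≤ n := by
      calc x.1 c ≤ ∑ c, x.1 c :=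
            Finset.single_le_sum (f := x.1) (fun _ _ => Nat.zero_le _) (Finset.mem_univ c)
        _ = n := x.2.1
    have hne := x.2.2 c
    rcases Nat.eq_zero_or_pos (x.1 c) with hz | hz
    · rw [hz]
      refine Finset.sum_eq_zero fun t ht => ?_
      rw [Finset.mem_Icc] at ht
      rw [if_neg (by omega), mul_zero]
    · rw [Finset.sum_eq_single (n - x.1 c)]
      · rw [if_pos (by omega), mul_one]
        omega
      · intro t _ ht
        rw [if_neg (by omega), mul_zero]
      · intro h
        rw [Finset.mem_Icc] at h
        omega
  have hb : (fun x => T.b n p i (T.vert n τ x)) =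
      (fun x => (n : ℤ) * ∑ t ∈ Finset.Icc 1 (n - i - 1), ((t : ℤ) + i - n) * T.faceA n p t τ x) +
        ((n : ℤ) - i) • ∑ c : Fin 3, (if T.char τ (Triangle.corner c) = p then
          (fun x : TriVertex n => (x.1 c : ℤ)) else 0) := by
    funext x
    have e1 : ∀ t ∈ Finset.Icc 1 (n - i - 1), T.a n p t (T.vert n τ x) = T.faceA n p t τ x := by
      intro t ht
      rw [Finset.mem_Icc] at ht
      exact T.a_vert n p (by omega) τ x
    have e2 : ∀ t ∈ Finset.Icc 1 (n - 1), T.a n p t (T.vert n τ x) = T.faceA n p t τ x := by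
      intro t ht
      rw [Finset.mem_Icc] at ht
      exact T.a_vert n p (by omega) τ x
    simp only [b, Pi.add_apply, Finset.sum_apply, Pi.smul_apply, smul_eq_mul, Finset.mul_sum]
    congr 1
    · refine Finset.sum_congr rfl fun t ht => ?_
      rw [e1 t ht]
      ring
    · rw [← Finset.mul_sum, ← Finset.mul_sum]
      congr 1
      rw [Finset.sum_congr rfl fun t ht => by rw [e2 t ht]]
      simp only [faceA, Finset.mul_sum]
      rw [Finset.sum_comm]
      refine Finset.sum_congr rfl fun c _ => ?_
      by_cases hc : T.char τ (Triangle.corner c) = p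
      · simp only [hc, true_and, if_true]
        exact hk x c
      · simp [hc]
  rw [hb]
  refine AddSubgroup.add_mem _ ?_ (AddSubgroup.zsmul_mem _ (AddSubgroup.sum_mem _ fun c _ => ?_) _)
  · exact AddSubgroup.subset_closure (Or.inr fun x => dvd_mul_right _ _)
  · split_ifs
    · exact AddSubgroup.subset_closure (Or.inl ⟨c, rfl⟩)
    · exact AddSubgroup.zero_mem _

end IdealTriangulation

end

/-!
# The center of the balanced Fock-Goncharov algebra at a root of unity

Monomials commute up to powers of the quantum parameter, and by the regular representation of the
quantum torus they are linearly independent. So the center is spanned by the monomials `Z^k` with `k`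
in `B_{N''}`, and everything reduces to the lattice identity `B_{N''} = N B_{λ,d} + B_λ°` with `B_λ°`
replaced by the group generated by the vectors `b(λ, p, i)`. In the algebra, negatives of these are
available since `-b = N (-b) + (N - 1) b`.

The lattice identity follows from one divisibility statement, `exists_eq_nsmul_add`: if `k` is balanced
and `k Q_λ` is divisible by `n m`, then `k` is `m` times a balanced vector plus a combination of the
vectors `b(λ, p, i)`. It applies to `k` in `B_{N''}` with `m = N`, because `k Q_λ` is divisible by `n`
for every balanced `k`, because `n` times each unit vector is balanced, and because `N = N' / gcd(N', n)`.

For the divisibility statement, the equation `k Q_λ = 0` modulo `n m` at a vertex in the interior of a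
face is an alternating sum over a hexagon. In terms of the three unit shifts, whose product is `1`, this
operator is `-(1 - X₁)(1 - X₂)(1 - X₃)`, so on each face `k` is a sum of three functions, each of one
barycentric coordinate (`exists_sum_of_hexagon`); they are thought of as attached to the corners. The
equations at the vertices of an ideal arc say that the second differences of the functions at
corresponding corners of the two adjacent faces agree. So the second differences depend only on the
puncture; they are divisible by `n` as `k` is balanced, and can be removed by the vectors `b(λ, p, i)`,
`i ≤ n - 2`, whose second differences are `-n` at `i`. What is left is linear on each face
(`exists_linear`), its slopes agree modulo `m` across ideal arcs, and are removed modulo `m` by the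
vectors `b(λ, p, n - 1)`.
-/

noncomputable section

/-! ### Commutation of monomials in the quantum torus -/

namespace QTorus

variable {V : Type*} (A : V → V → ℤ) (h : ℂˣ)

/-- `x` and `y` commute up to the scalar `c`, placed as in `x y = c y x`. -/
def ScalarCommute (c : ℂˣ) (x y : (QTorus A h)ˣ) : Prop := x * y = scalar A h c * (y * x)

variable {A h}

namespace ScalarCommute

variable {c c' : ℂˣ} {x x' y y' : (QTorus A h)ˣ}

theorem symm (hxy : ScalarCommute A h c x y) : ScalarCommute A h c⁻¹ y x := by
  unfold ScalarCommute at *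
  rw [hxy, map_inv, inv_mul_cancel_left]

theorem one_left (y : (QTorus A h)ˣ) : ScalarCommute A h 1 1 y := by
  simp [ScalarCommute]

theorem mul_left (h1 : ScalarCommute A h c x y) (h2 : ScalarCommute A h c' x' y) :
    ScalarCommute A h (c * c') (x * x') y := by
  unfold ScalarCommute at *
  rw [mul_assoc, h2, ← mul_assoc x, ← scalar_comm, mul_assoc, ← mul_assoc x, h1, map_mul,
    scalar_comm A h c (scalar A h c')]
  simp only [mul_assoc]

theorem inv_left (h1 : ScalarCommute A h c x y) : ScalarCommute A h c⁻¹ x⁻¹ y := by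
  unfold ScalarCommute at *
  have h2 : y * x = scalar A h c⁻¹ * (x * y) := by rw [h1, map_inv, inv_mul_cancel_left]
  calc x⁻¹ * y = x⁻¹ * (y * x) * x⁻¹ := by group
    _ = scalar A h c⁻¹ * (y * x⁻¹) := by
        rw [h2, ← mul_assoc x⁻¹, ← scalar_comm]
        simp only [mul_assoc, inv_mul_cancel_left]

theorem pow_left (h1 : ScalarCommute A h c x y) (m : ℕ) :
    ScalarCommute A h (c ^ m) (x ^ m) y := by
  induction m with
  | zero => simpa using one_left y
  | succ m ih => rw [pow_succ, pow_succ]; exact ih.mul_left h1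

theorem zpow_left (h1 : ScalarCommute A h c x y) (m : ℤ) :
    ScalarCommute A h (c ^ m) (x ^ m) y := by
  obtain ⟨a, rfl | rfl⟩ := m.eq_nat_or_neg
  · simpa using h1.pow_left a
  · simpa using (h1.pow_left a).inv_left

theorem scalar_left (d : ℂˣ) (y : (QTorus A h)ˣ) : ScalarCommute A h 1 (scalar A h d) y := by
  simp [ScalarCommute, scalar_comm]

theorem listProd_left {f : V → ℤ} (hy : ∀ v, ScalarCommute A h (h ^ f v) (gen A h v) y)
    (l : List (V × ℤ)) :
    ScalarCommute A h (h ^ (l.map fun p => p.2 * f p.1).sum) (listProd A h l) y := by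
  induction l with
  | nil => simpa [listProd] using one_left y
  | cons p l ih =>
    have h1 := ((hy p.1).zpow_left p.2).mul_left ih
    rw [← zpow_mul, ← zpow_add] at h1
    simpa [listProd, mul_comm] using h1

end ScalarCommute

variable (A h)

variable [Fintype V]

/-- The monomial `Z^k` as an invertible element. -/
def unitMonomial (k : V → ℤ) : (QTorus A h)ˣ :=
  scalar A h (h ^ (-weylExponent A (Finset.univ.toList.map fun v => (v, k v)))) *
    listProd A h (Finset.univ.toList.map fun v => (v, k v))

theorem coe_unitMonomial (k : V → ℤ) : (unitMonomial A h k : QTorus A h) = monomial A h k := by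
  rw [unitMonomial, Units.val_mul, monomial, weyl, Algebra.smul_def]
  rfl

/-- Monomials commute up to the power of `h` given by the bilinear form of `A`. -/
theorem monomial_mul_comm (hA : ∀ v w, A w v = -A v w) (k t : V → ℤ) :
    monomial A h k * monomial A h t =
      ((h ^ (2 * ∑ u, ∑ v, k u * A u v * t v) : ℂˣ) : ℂ) •
        (monomial A h t * monomial A h k) := by
  have e : ∀ f : V → ℤ, (Finset.univ.toList.map f).sum = ∑ v, f v := fun f =>
    Finset.sum_map_toList _ _
  have h1 : ∀ w, ScalarCommute A h (h ^ (∑ v, t v * (2 * A v w))) (unitMonomial A h t)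
      (gen A h w) := by
    intro w
    have := (ScalarCommute.scalar_left (A := A) (h := h)
        (h ^ (-weylExponent A (Finset.univ.toList.map fun v => (v, t v)))) (gen A h w)).mul_left
      (ScalarCommute.listProd_left (f := fun v => 2 * A v w) (fun v => gen_mul_gen A h v w)
        (Finset.univ.toList.map fun v => (v, t v)))
    rw [one_mul, List.map_map] at this
    simp only [Function.comp_def, e] at this
    exact this
  have h2 : ScalarCommute A h (h ^ (2 * ∑ u, ∑ v, k u * A u v * t v)) (unitMonomial A h k)
      (unitMonomial A h t) := by
    have := (ScalarCommute.scalar_left (A := A) (h := h)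
        (h ^ (-weylExponent A (Finset.univ.toList.map fun v => (v, k v))))
          (unitMonomial A h t)).mul_left
      (ScalarCommute.listProd_left (f := fun w => -(∑ v, t v * (2 * A v w)))
        (fun v => by rw [zpow_neg]; exact (h1 v).symm)
        (Finset.univ.toList.map fun v => (v, k v)))
    rw [one_mul, List.map_map] at this
    simp only [Function.comp_def, e] at this
    have h3 : ∑ u, k u * -∑ v, t v * (2 * A v u) = 2 * ∑ u, ∑ v, k u * A u v * t v := by
      rw [Finset.mul_sum]
      refine Finset.sum_congr rfl fun u _ => ?_
      rw [Finset.mul_sum, ← Finset.sum_neg_distrib, Finset.mul_sum]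
      refine Finset.sum_congr rfl fun v _ => ?_
      rw [hA u v]
      ring
    rw [h3] at this
    exact this
  have h3 := congrArg Units.val h2
  rw [Units.val_mul, Units.val_mul, Units.val_mul, coe_unitMonomial, coe_unitMonomial] at h3
  rw [h3, Algebra.smul_def]
  rfl

theorem isUnit_monomial (k : V → ℤ) : IsUnit (monomial A h k) :=
  ⟨unitMonomial A h k, coe_unitMonomial A h k⟩

theorem mono_zero (Λ : AddSubgroup (V → ℤ)) : mono A h Λ 0 = 1 :=
  Subtype.ext (monomial_zero A h)

theorem mono_mem_center {Λ : AddSubgroup (V → ℤ)} (hA : ∀ v w, A w v = -A v w) (k : Λ)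
    (hk : ∀ t ∈ Λ, h ^ (2 * ∑ u, ∑ v, (k : V → ℤ) u * A u v * t v) = 1) :
    mono A h Λ k ∈ Subalgebra.center ℂ (monomialSubalgebra A h Λ) := by
  rw [Subalgebra.mem_center_iff]
  rintro ⟨y, hy⟩
  refine Subtype.ext ?_
  show y * monomial A h k = monomial A h k * y
  change y ∈ Submodule.span ℂ (monomial A h '' (Λ : Set (V → ℤ))) at hy
  induction hy using Submodule.span_induction with
  | zero => simp
  | add x y _ _ h1 h2 => rw [add_mul, mul_add, h1, h2]
  | smul c x _ h1 => rw [smul_mul_assoc, mul_smul_comm, h1]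
  | mem x hx =>
    obtain ⟨t, ht, rfl⟩ := hx
    rw [monomial_mul_comm A h hA k t, hk t ht, Units.val_one, one_smul]

end QTorus

/-! ### The regular representation -/

namespace QTorus

variable {V : Type*} (A : V → V → ℤ) (h : ℂˣ)

/-- The operator `e_k ↦ h ^ (σ k) e_{k + δ}` on the free module with basis `e_k`, `k ∈ ℤ^V`. -/
def shiftOp (σ : (V → ℤ) → ℤ) (δ : V → ℤ) : Module.End ℂ ((V → ℤ) →₀ ℂ) :=
  Finsupp.lift _ ℂ _ fun k => Finsupp.single (k + δ) ((h ^ σ k : ℂˣ) : ℂ)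

theorem shiftOp_single (σ : (V → ℤ) → ℤ) (δ k : V → ℤ) (c : ℂ) :
    shiftOp h σ δ (Finsupp.single k c) = Finsupp.single (k + δ) (c * ((h ^ σ k : ℂˣ) : ℂ)) := by
  simp [shiftOp]

/-- An operator that maps each basis vector `e_l` to a nonzero multiple of `e_{l + δ}`. -/
def IsShift (δ : V → ℤ) (f : Module.End ℂ ((V → ℤ) →₀ ℂ)) : Prop :=
  ∀ l, ∃ c : ℂ, c ≠ 0 ∧ f (Finsupp.single l 1) = Finsupp.single (l + δ) c

variable [Fintype V] [DecidableEq V]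

/-- The action of the letters on the free module with basis `e_k`, `k ∈ ℤ^V`: the letter `Z_v` maps
`e_k` to `h ^ (∑ w, A v w * k w)` times the basis vector of `k + δ_v`, and `Z_v⁻¹` acts by
the inverse operator. -/
def letterOp : V ⊕ V → Module.End ℂ ((V → ℤ) →₀ ℂ) :=
  Sum.elim (fun v => shiftOp h (fun k => ∑ w, A v w * k w) (Pi.single v 1))
    (fun v => shiftOp h (fun k => -∑ w, A v w * (k - Pi.single v 1 : V → ℤ) w) (-Pi.single v 1))

variable {A}

/-- The regular representation of the quantum torus. -/
def regularRep (hA : ∀ v w, A w v = -A v w) : QTorus A h →ₐ[ℂ] Module.End ℂ ((V → ℤ) →₀ ℂ) :=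
  RingQuot.liftAlgHom ℂ ⟨FreeAlgebra.lift ℂ (letterOp A h), by
    intro x y hxy
    induction hxy with
    | mul_inv v =>
      simp only [map_mul, FreeAlgebra.lift_ι_apply, letterOp, Sum.elim_inl, Sum.elim_inr, map_one]
      refine Finsupp.lhom_ext fun k c => ?_
      rw [Module.End.mul_apply, shiftOp_single, shiftOp_single, Module.End.one_apply, zpow_neg,
        ← sub_eq_add_neg, sub_add_cancel, mul_assoc, Units.inv_mul, mul_one]
    | inv_mul v =>
      simp only [map_mul, FreeAlgebra.lift_ι_apply, letterOp, Sum.elim_inl, Sum.elim_inr, map_one]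
      refine Finsupp.lhom_ext fun k c => ?_
      rw [Module.End.mul_apply, shiftOp_single, shiftOp_single, Module.End.one_apply, zpow_neg,
        add_neg_cancel_right, add_sub_cancel_right, mul_assoc, Units.mul_inv, mul_one]
    | comm v w =>
      simp only [map_mul, map_smul, FreeAlgebra.lift_ι_apply, letterOp, Sum.elim_inl]
      refine Finsupp.lhom_ext fun k c => ?_
      have e : ∀ v w, ∑ u, A v u * (k + Pi.single w 1 : V → ℤ) u = ∑ u, A v u * k u + A v w := by
        intro v w
        simp [mul_add, Finset.sum_add_distrib, Pi.single_apply]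
      rw [LinearMap.smul_apply, Module.End.mul_apply, Module.End.mul_apply, shiftOp_single,
        shiftOp_single, shiftOp_single, shiftOp_single, Finsupp.smul_single, add_right_comm, e, e,
        smul_eq_mul]
      congr 1
      rw [mul_assoc c, ← Units.val_mul, ← zpow_add, mul_left_comm, mul_assoc c, ← Units.val_mul,
        ← zpow_add]
      have e2 : ∑ u, A w u * k u + (∑ u, A v u * k u + A v w) =
          ∑ u, A v u * k u + (2 * A v w + (∑ u, A w u * k u + A w v)) := by
        rw [hA v w]
        ring
      rw [e2, zpow_add h (∑ u, A v u * k u), Units.val_mul]⟩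

variable (hA : ∀ v w, A w v = -A v w)

theorem isShift_gen (v : V) : IsShift (Pi.single v 1) (regularRep h hA (gen A h v)) := by
  intro l
  refine ⟨((h ^ (∑ w, A v w * l w) : ℂˣ) : ℂ), Units.ne_zero _, ?_⟩
  show regularRep h hA (RingQuot.mkAlgHom ℂ _ (FreeAlgebra.ι ℂ (Sum.inl v))) _ = _
  rw [regularRep, RingQuot.liftAlgHom_mkAlgHom_apply, FreeAlgebra.lift_ι_apply, letterOp,
    Sum.elim_inl, shiftOp_single, one_mul]

variable {h} {hA}

theorem IsShift.mul {δ ε : V → ℤ} {x y : QTorus A h} (hx : IsShift δ (regularRep h hA x))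
    (hy : IsShift ε (regularRep h hA y)) : IsShift (δ + ε) (regularRep h hA (x * y)) := by
  intro l
  obtain ⟨c, hc, h1⟩ := hy l
  obtain ⟨d, hd, h2⟩ := hx (l + ε)
  refine ⟨c * d, mul_ne_zero hc hd, ?_⟩
  have e : (Finsupp.single (l + ε) c : (V → ℤ) →₀ ℂ) = c • Finsupp.single (l + ε) 1 := by simp
  rw [map_mul, Module.End.mul_apply, h1, e, map_smul, h2, Finsupp.smul_single, smul_eq_mul,
    add_assoc, add_comm ε]

theorem isShift_one : IsShift 0 (regularRep h hA 1) := fun l =>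
  ⟨1, one_ne_zero, by rw [map_one, add_zero, Module.End.one_apply]⟩

theorem isShift_scalar (c : ℂˣ) : IsShift 0 (regularRep h hA (scalar A h c)) := fun l =>
  ⟨c, c.ne_zero, by
    show regularRep h hA (algebraMap ℂ _ (c : ℂ)) _ = _
    rw [AlgHom.commutes, add_zero, Module.algebraMap_end_apply, Finsupp.smul_single, smul_eq_mul,
      mul_one]⟩

theorem IsShift.inv {δ : V → ℤ} {x : (QTorus A h)ˣ} (hx : IsShift δ (regularRep h hA x)) :
    IsShift (-δ) (regularRep h hA (x⁻¹ : (QTorus A h)ˣ)) := by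
  intro l
  obtain ⟨c, hc, h1⟩ := hx (l - δ)
  refine ⟨c⁻¹, inv_ne_zero hc, ?_⟩
  have h2 : regularRep h hA (x⁻¹ : (QTorus A h)ˣ) (regularRep h hA x (Finsupp.single (l - δ) 1)) =
      Finsupp.single (l - δ) 1 := by
    rw [← Module.End.mul_apply, ← map_mul, Units.inv_mul, map_one, Module.End.one_apply]
  rw [h1, sub_add_cancel] at h2
  have e : (Finsupp.single l 1 : (V → ℤ) →₀ ℂ) = c⁻¹ • Finsupp.single l c := by simp [hc]
  rw [e, map_smul, h2, Finsupp.smul_single, sub_eq_add_neg, smul_eq_mul, mul_one]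

theorem IsShift.zpow {δ : V → ℤ} {x : (QTorus A h)ˣ} (hx : IsShift δ (regularRep h hA x)) (a : ℤ) :
    IsShift (a • δ) (regularRep h hA (x ^ a : (QTorus A h)ˣ)) := by
  have hpow : ∀ m : ℕ, IsShift (m • δ) (regularRep h hA (x ^ m : (QTorus A h)ˣ)) := by
    intro m
    induction m with
    | zero => simpa using isShift_one (h := h) (hA := hA)
    | succ m ih =>
      rw [succ_nsmul, pow_succ, Units.val_mul]
      exact ih.mul hx
  obtain ⟨m, rfl | rfl⟩ := a.eq_nat_or_neg
  · simpa only [zpow_natCast, natCast_zsmul] using hpow m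
  · have := (hpow m).inv
    rwa [← zpow_natCast, ← zpow_neg, ← natCast_zsmul, ← neg_smul] at this

variable (h) (hA)

theorem isShift_monomial (k : V → ℤ) : IsShift k (regularRep h hA (monomial A h k)) := by
  have hl : ∀ l : List V, IsShift (l.map fun v => k v • (Pi.single v 1 : V → ℤ)).sum
      (regularRep h hA (listProd A h (l.map fun v => (v, k v)))) := by
    intro l
    induction l with
    | nil => simpa [listProd] using isShift_one (h := h) (hA := hA)
    | cons v l ih =>
      simp only [List.map_cons, List.sum_cons, listProd, List.prod_cons, Units.val_mul]
      exact ((isShift_gen h hA v).zpow (k v)).mul ih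
  have hs := (isShift_scalar (hA := hA)
    (h ^ (-weylExponent A (Finset.univ.toList.map fun v => (v, k v))))).mul (hl Finset.univ.toList)
  rw [← Units.val_mul, zero_add] at hs
  have e : (Finset.univ.toList.map fun v => k v • (Pi.single v 1 : V → ℤ)).sum = k := by
    rw [Finset.sum_map_toList]
    funext w
    simp [Pi.single_apply]
  rw [e] at hs
  rw [← coe_unitMonomial]
  exact hs

theorem linearIndependent_monomial (hA : ∀ v w, A w v = -A v w) :
    LinearIndependent ℂ (monomial A h) := by
  choose c hc hcs using fun k => isShift_monomial h hA k 0
  have h1 : LinearIndependent ℂ fun k : V → ℤ => regularRep h hA (monomial A h k)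
      (Finsupp.single 0 1) := by
    have h2 : (fun k : V → ℤ => regularRep h hA (monomial A h k) (Finsupp.single 0 1)) =
        (fun k => Units.mk0 (c k) (hc k)) • (fun k => (Finsupp.single k 1 : (V → ℤ) →₀ ℂ)) := by
      funext k
      rw [hcs, Pi.smul_apply', Units.smul_mk0, Finsupp.smul_single, zero_add, smul_eq_mul, mul_one]
    rw [h2]
    refine LinearIndependent.units_smul ?_ _
    simpa using (Finsupp.basisSingleOne (R := ℂ) (ι := V → ℤ)).linearIndependent
  exact LinearIndependent.of_comp
    ((LinearMap.applyₗ (Finsupp.single (0 : V → ℤ) (1 : ℂ))).comp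
      (regularRep h hA).toLinearMap) h1

theorem monomial_ne_zero (hA : ∀ v w, A w v = -A v w) (k : V → ℤ) : monomial A h k ≠ 0 :=
  (linearIndependent_monomial h hA).ne_zero k

/-- Central elements of a monomial subalgebra are spanned by those of its monomials that commute with
all the others. -/
theorem mem_span_of_mem_center (hA : ∀ v w, A w v = -A v w) (Λ : AddSubgroup (V → ℤ))
    {x : monomialSubalgebra A h Λ} (hx : x ∈ Subalgebra.center ℂ (monomialSubalgebra A h Λ)) :
    (x : QTorus A h) ∈ Submodule.span ℂ (monomial A h '' {k | k ∈ Λ ∧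
      ∀ t ∈ Λ, h ^ (2 * ∑ u, ∑ v, k u * A u v * t v) = 1}) := by
  have hx1 : (x : QTorus A h) ∈ Submodule.span ℂ (monomial A h '' (Λ : Set (V → ℤ))) := x.2
  obtain ⟨f, hf, hfx⟩ := (Finsupp.mem_span_image_iff_linearCombination ℂ).1 hx1
  rw [Finsupp.mem_supported] at hf
  refine (Finsupp.mem_span_image_iff_linearCombination ℂ).2 ⟨f, ?_, hfx⟩
  rw [Finsupp.mem_supported]
  intro k hk
  refine ⟨hf hk, fun t ht => ?_⟩
  have hc : monomial A h t * x = x * monomial A h t := by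
    have := congrArg Subtype.val (Subalgebra.mem_center_iff.1 hx (mono A h Λ ⟨t, ht⟩))
    exact this
  -- comparing coefficients of `Z^t x` and `x Z^t`
  have h2 : monomial A h t * f.sum (fun k c =>
      (c * (((h ^ (2 * ∑ u, ∑ v, k u * A u v * t v) : ℂˣ) : ℂ) - 1)) • monomial A h k) = 0 := by
    rw [← hfx, Finsupp.linearCombination_apply, Finsupp.sum, Finset.mul_sum, Finset.sum_mul] at hc
    rw [Finsupp.sum, Finset.mul_sum, ← sub_eq_zero.2 hc.symm, ← Finset.sum_sub_distrib]
    refine Finset.sum_congr rfl fun k _ => ?_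
    rw [smul_mul_assoc, monomial_mul_comm A h hA k t, mul_smul_comm, mul_smul_comm, smul_smul,
      ← sub_smul, mul_sub, mul_one]
  rw [(isUnit_monomial A h t).mul_right_eq_zero] at h2
  have h3 := linearIndependent_iff'.1 (linearIndependent_monomial h hA) f.support _ h2 k hk
  rcases mul_eq_zero.1 h3 with h4 | h4
  · exact absurd h4 (Finsupp.mem_support_iff.1 hk)
  · exact Units.ext (sub_eq_zero.1 h4)

theorem mono_add_mem (hA : ∀ v w, A w v = -A v w) (Λ : AddSubgroup (V → ℤ))
    {R : Subalgebra ℂ (monomialSubalgebra A h Λ)} {k t : Λ} (hk : mono A h Λ k ∈ R)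
    (ht : mono A h Λ t ∈ R) : mono A h Λ (k + t) ∈ R := by
  obtain ⟨c, hc⟩ := exists_monomial_mul A h (k : V → ℤ) t
  have hc0 : c ≠ 0 := by
    rintro rfl
    rw [zero_smul, (isUnit_monomial A h _).mul_right_eq_zero] at hc
    exact monomial_ne_zero h hA _ hc
  have h1 : mono A h Λ (k + t) = c⁻¹ • (mono A h Λ k * mono A h Λ t) := by
    refine Subtype.ext ?_
    show monomial A h (k + t : V → ℤ) = c⁻¹ • (monomial A h k * monomial A h t)
    rw [hc, smul_smul, inv_mul_cancel₀ hc0, one_smul]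
  rw [h1]
  exact R.smul_mem (R.mul_mem hk ht) _

theorem mono_nsmul_mem (hA : ∀ v w, A w v = -A v w) (Λ : AddSubgroup (V → ℤ))
    {R : Subalgebra ℂ (monomialSubalgebra A h Λ)} {k : Λ} (hk : mono A h Λ k ∈ R) (m : ℕ) :
    mono A h Λ (m • k) ∈ R := by
  induction m with
  | zero =>
    rw [zero_smul, mono_zero A h Λ]
    exact R.one_mem
  | succ m ih =>
    rw [succ_nsmul]
    exact mono_add_mem h hA Λ ih hk

/-- A subalgebra with the monomials of a set of exponents contains the monomials of the group
generated by this set, provided that it contains the `N`-th multiples: negatives are obtained from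
`-x = N (-x) + (N - 1) x`. -/
theorem exists_mono_mem_of_mem_closure (hA : ∀ v w, A w v = -A v w) (Λ : AddSubgroup (V → ℤ))
    {R : Subalgebra ℂ (monomialSubalgebra A h Λ)} {s : Set (V → ℤ)} {N : ℕ} (hN : N ≠ 0)
    (hs : ∀ x ∈ s, ∃ hx : x ∈ Λ, mono A h Λ ⟨x, hx⟩ ∈ R)
    (hNs : ∀ x : Λ, (x : V → ℤ) ∈ AddSubgroup.closure s → mono A h Λ (N • x) ∈ R)
    {x : V → ℤ} (hx : x ∈ AddSubgroup.closure s) : ∃ hx : x ∈ Λ, mono A h Λ ⟨x, hx⟩ ∈ R := by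
  induction hx using AddSubgroup.closure_induction with
  | mem x hx => exact hs x hx
  | zero =>
    refine ⟨Λ.zero_mem, ?_⟩
    have := R.one_mem
    rwa [← mono_zero A h Λ] at this
  | add x y _ _ h1 h2 =>
    obtain ⟨hx, h1⟩ := h1
    obtain ⟨hy, h2⟩ := h2
    exact ⟨Λ.add_mem hx hy, mono_add_mem h hA Λ (k := ⟨x, hx⟩) (t := ⟨y, hy⟩) h1 h2⟩
  | neg x hx h1 =>
    obtain ⟨hxΛ, h1⟩ := h1
    obtain ⟨y, rfl⟩ : ∃ y : Λ, (y : V → ℤ) = x := ⟨⟨x, hxΛ⟩, rfl⟩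
    have h2 := hNs (-y) (AddSubgroup.neg_mem _ hx)
    have h3 := mono_add_mem h hA Λ h2 (mono_nsmul_mem h hA Λ (k := y) h1 (N - 1))
    have h4 : N • -y + (N - 1) • y = -y := by
      obtain ⟨m, rfl⟩ := Nat.exists_eq_succ_of_ne_zero hN
      rw [Nat.succ_sub_one, succ_nsmul, smul_neg, neg_add_cancel_comm]
    rw [h4] at h3
    exact ⟨(-y).2, h3⟩

end QTorus

/-! ### Vectors on a triangle -/

namespace TriVertex

variable {n : ℕ}

/-- The triple with entries `a, b, c` at the places `i, i + 1, i + 2`. -/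
def coords (i : Fin 3) (a b c : ℕ) : Fin 3 → ℕ :=
  fun j => if j = i then a else if j = i + 1 then b else c

theorem coords_zero (i : Fin 3) (a b c : ℕ) : coords i a b c i = a := by
  simp [coords]

theorem coords_one (i : Fin 3) (a b c : ℕ) : coords i a b c (i + 1) = b := by
  fin_cases i <;> simp [coords]

theorem coords_two (i : Fin 3) (a b c : ℕ) : coords i a b c (i + 2) = c := by
  fin_cases i <;> simp [coords]

theorem sum_eq_rotate {R : Type*} [AddCommMonoid R] (f : Fin 3 → R) (i : Fin 3) :
    ∑ c, f c = f i + f (i + 1) + f (i + 2) := by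
  rw [Fin.sum_univ_three]
  fin_cases i
  · simp
  · simp only [Fin.mk_one, Fin.reduceAdd]
    abel
  · simp only [Fin.reduceFinMk, Fin.reduceAdd]
    abel

theorem forall_rotate {P : Fin 3 → Prop} (i : Fin 3) :
    (∀ c, P c) ↔ P i ∧ P (i + 1) ∧ P (i + 2) := by
  rw [Fin.forall_fin_succ, Fin.forall_fin_two]
  fin_cases i <;> simp <;> tauto

theorem eq_coords_iff (x : Fin 3 → ℕ) (i : Fin 3) (a b c : ℕ) :
    x = coords i a b c ↔ x i = a ∧ x (i + 1) = b ∧ x (i + 2) = c := by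
  rw [funext_iff, forall_rotate i, coords_zero, coords_one, coords_two]

theorem coords_rotate (i : Fin 3) (a b c : ℕ) : coords (i + 1) b c a = coords i a b c := by
  fin_cases i <;> funext j <;> fin_cases j <;> simp [coords]

/-- The value of a function on small vertices at a triple of natural numbers; it is `0` at triples
that are not small vertices, in particular at the corners. -/
def extend (κ : TriVertex n → ℤ) (x : Fin 3 → ℕ) : ℤ := by
  classical
  exact if hx : ∑ c, x c = n ∧ ∀ c, x c ≠ n then κ ⟨x, hx⟩ else 0

/-- The value of a function on small vertices at the point with coordinates `a, b, c` at the places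
`i, i + 1, i + 2`; it is `0` if this is not a small vertex. -/
def val (κ : TriVertex n → ℤ) (i : Fin 3) (a b c : ℕ) : ℤ := extend κ (coords i a b c)

theorem isVertex_coords (i : Fin 3) {a b c : ℕ} :
    (∑ k, coords i a b c k = n ∧ ∀ k, coords i a b c k ≠ n) ↔
      a + b + c = n ∧ a ≠ n ∧ b ≠ n ∧ c ≠ n := by
  rw [sum_eq_rotate _ i, forall_rotate i, coords_zero, coords_one, coords_two]

theorem extend_coe (κ : TriVertex n → ℤ) (x : TriVertex n) : extend κ x.1 = κ x := by
  rw [extend, dif_pos x.2]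

theorem val_eq (κ : TriVertex n → ℤ) (i : Fin 3) {a b c : ℕ}
    (hx : ∑ k, coords i a b c k = n ∧ ∀ k, coords i a b c k ≠ n) :
    val κ i a b c = κ ⟨coords i a b c, hx⟩ := by
  rw [val, extend, dif_pos hx]

theorem val_eq_zero (κ : TriVertex n → ℤ) (i : Fin 3) {a b c : ℕ}
    (hx : ¬ (a + b + c = n ∧ a ≠ n ∧ b ≠ n ∧ c ≠ n)) : val κ i a b c = 0 := by
  rw [val, extend, dif_neg (by rwa [isVertex_coords])]

theorem val_rotate (κ : TriVertex n → ℤ) (i : Fin 3) (a b c : ℕ) :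
    val κ (i + 1) b c a = val κ i a b c := by
  rw [val, val, coords_rotate]

theorem val_rotate' (κ : TriVertex n → ℤ) (i : Fin 3) (a b c : ℕ) :
    val κ (i + 2) c a b = val κ i a b c := by
  rw [← val_rotate κ i, ← val_rotate κ (i + 1), add_assoc]
  rfl

/-- The vector `2 κ Q` of the ideal triangle. -/
def flux (κ : TriVertex n → ℤ) (y : TriVertex n) : ℤ := ∑ x, κ x * doubledQ x y

/-- Twice the weight of an arrow whose coordinate at the opposite corner is `c`. -/
def weight (c : ℕ) : ℤ := if c = 0 then 1 else 2

theorem sum_eq_val (κ : TriVertex n → ℤ) (i : Fin 3) (a b c : ℕ) (w : ℤ)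
    (P : TriVertex n → Prop) [DecidablePred P] (hP : ∀ x, P x ↔ x.1 = coords i a b c) :
    ∑ x, κ x * (if P x then w else 0) = w * val κ i a b c := by
  by_cases hx : ∑ k, coords i a b c k = n ∧ ∀ k, coords i a b c k ≠ n
  · rw [val_eq κ i hx, Finset.sum_eq_single (⟨coords i a b c, hx⟩ : TriVertex n),
      if_pos ((hP _).2 rfl), mul_comm]
    · intro x _ hne
      rw [if_neg (fun h1 => hne (Subtype.ext ((hP x).1 h1))), mul_zero]
    · exact fun h1 => absurd (Finset.mem_univ _) h1
  · rw [val_eq_zero κ i (by rwa [isVertex_coords] at hx), mul_zero]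
    refine Finset.sum_eq_zero fun x _ => ?_
    rw [if_neg (fun h1 => hx ((hP x).1 h1 ▸ x.2)), mul_zero]

/-- At each small vertex, the flux is the alternating sum over the neighbouring hexagon. -/
theorem flux_eq (κ : TriVertex n → ℤ) (y : TriVertex n) :
    flux κ y = ∑ i : Fin 3, weight (y.1 (i + 2)) *
      (val κ i (y.1 i + 1) (y.1 (i + 1) - 1) (y.1 (i + 2)) -
        val κ i (y.1 i - 1) (y.1 (i + 1) + 1) (y.1 (i + 2))) := by
  classical
  simp only [flux, doubledQ, doubledArrow, mul_sub, Finset.mul_sum, Finset.sum_sub_distrib]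
  refine congrArg₂ _ (Finset.sum_comm.trans (Finset.sum_congr rfl fun i _ => ?_))
    (Finset.sum_comm.trans (Finset.sum_congr rfl fun i _ => ?_))
  · have h2 : ∀ x : TriVertex n, κ x * (if y.1 i + 1 = x.1 i ∧ y.1 (i + 1) = x.1 (i + 1) + 1 ∧
        y.1 (i + 2) = x.1 (i + 2) then (if x.1 (i + 2) = 0 then (1 : ℤ) else 2) else 0) =
        κ x * (if y.1 i + 1 = x.1 i ∧ y.1 (i + 1) = x.1 (i + 1) + 1 ∧
        y.1 (i + 2) = x.1 (i + 2) then weight (y.1 (i + 2)) else 0) := by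
      intro x
      split_ifs with h2 h3
      · rw [weight, if_pos (by omega)]
      · rw [weight, if_neg (by omega)]
      · rfl
    simp only [h2]
    refine sum_eq_val κ i _ _ _ (weight (y.1 (i + 2))) (fun x => y.1 i + 1 = x.1 i ∧
      y.1 (i + 1) = x.1 (i + 1) + 1 ∧ y.1 (i + 2) = x.1 (i + 2)) fun x => ?_
    rw [eq_coords_iff]
    have hx := x.2.1
    have hy := y.2.1
    rw [sum_eq_rotate _ i] at hx hy
    omega
  · refine sum_eq_val κ i _ _ _ (weight (y.1 (i + 2))) (fun x => x.1 i + 1 = y.1 i ∧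
      x.1 (i + 1) = y.1 (i + 1) + 1 ∧ x.1 (i + 2) = y.1 (i + 2)) fun x => ?_
    rw [eq_coords_iff]
    have hx := x.2.1
    have hy := y.2.1
    rw [sum_eq_rotate _ i] at hx hy
    omega

theorem flux_interior (κ : TriVertex n → ℤ) (i : Fin 3) (a b c : ℕ) (y : TriVertex n)
    (hy : y.1 = coords i (a + 1) (b + 1) (c + 1)) :
    flux κ y = 2 * ((val κ i (a + 2) b (c + 1) - val κ i a (b + 2) (c + 1)) +
      (val κ i (a + 1) (b + 2) c - val κ i (a + 1) b (c + 2)) +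
      (val κ i a (b + 1) (c + 2) - val κ i (a + 2) (b + 1) c)) := by
  have e3 : i + 1 + 2 = i := by rw [add_assoc]; exact add_zero i
  have e4 : i + 2 + 2 = i + 1 := by rw [add_assoc]; rfl
  have e5 : i + 2 + 1 = i := by rw [add_assoc]; exact add_zero i
  have e6 : i + 1 + 1 = i + 2 := by rw [add_assoc]; rfl
  rw [flux_eq, sum_eq_rotate _ i]
  simp only [hy, e3, e4, e5, e6, coords_zero, coords_one, coords_two, val_rotate, val_rotate',
    weight, Nat.add_sub_cancel]
  simp only [Nat.add_eq_zero_iff, one_ne_zero, and_false, if_false]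
  ring

/-- The flux at a vertex of the edge `i`. -/
theorem flux_edge (κ : TriVertex n → ℤ) (i : Fin 3) (a b : ℕ) (y : TriVertex n)
    (hy : y.1 = coords i (a + 1) (b + 1) 0) :
    flux κ y = (val κ i (a + 2) b 0 - val κ i a (b + 2) 0) +
      2 * (val κ i a (b + 1) 1 - val κ i (a + 1) b 1) := by
  have e3 : i + 1 + 2 = i := by rw [add_assoc]; exact add_zero i
  have e4 : i + 2 + 2 = i + 1 := by rw [add_assoc]; rfl
  have e5 : i + 2 + 1 = i := by rw [add_assoc]; exact add_zero i
  have e6 : i + 1 + 1 = i + 2 := by rw [add_assoc]; rfl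
  have hsum := y.2.1
  rw [sum_eq_rotate _ i, hy, coords_zero, coords_one, coords_two] at hsum
  rw [flux_eq, sum_eq_rotate _ i]
  simp only [hy, e3, e4, e5, e6, coords_zero, coords_one, coords_two, val_rotate, val_rotate',
    weight, Nat.add_sub_cancel]
  simp only [Nat.add_eq_zero_iff, one_ne_zero, and_false, if_false, if_true]
  -- truncated subtraction gives points outside the triangle
  rw [val_eq_zero κ i (a := a + 1) (b := b + 1 + 1) (c := 0 - 1) (by omega),
    val_eq_zero κ i (a := a + 1 + 1) (b := b + 1) (c := 0 - 1) (by omega)]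
  ring

end TriVertex

/-! ### Sums of functions of one barycentric coordinate -/

/-- The second difference of a sequence. -/
def secondDiff (g : ℕ → ℤ) (x : ℕ) : ℤ := g (x + 2) - 2 * g (x + 1) + g x

theorem dvd_sub_affine_of_secondDiff {M : ℤ} {g : ℕ → ℤ} {n : ℕ}
    (hg : ∀ x, x + 3 ≤ n → M ∣ secondDiff g x) :
    ∀ x, x + 1 ≤ n → M ∣ g x - (g 0 + x * (g 1 - g 0)) := by
  intro x
  induction x using Nat.twoStepInduction with
  | zero => simp
  | one => simp
  | more x h1 h2 =>
    intro hx
    have h3 := hg x (by omega)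
    have h4 := dvd_add h3 (dvd_sub ((h2 (by omega)).mul_left 2) (h1 (by omega)))
    refine h4.trans (dvd_of_eq ?_)
    simp only [secondDiff]
    push_cast
    ring

/-- The hexagon operator is `-(1 - X₁)(1 - X₂)(1 - X₃)` for the three unit shifts `X₁, X₂, X₃`, so its
kernel consists of the sums of functions of one barycentric coordinate. -/
theorem exists_sum_of_hexagon {n : ℕ} {M : ℤ} (f : ℕ → ℕ → ℕ → ℤ)
    (hf : ∀ a b c, a + b + c + 3 = n → M ∣ (f (a + 2) b (c + 1) - f a (b + 2) (c + 1)) +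
      (f (a + 1) (b + 2) c - f (a + 1) b (c + 2)) +
      (f a (b + 1) (c + 2) - f (a + 2) (b + 1) c)) :
    ∃ g₁ g₂ g₃ : ℕ → ℤ, ∀ a b c, a + b + c = n → a ≠ n → b ≠ n → c ≠ n →
      M ∣ f a b c - (g₁ a + g₂ b + g₃ c) := by
  -- `g₁` and `g₂` are read off from the zigzag between the rows `c = 0` and `c = 1`
  let g₁ : ℕ → ℤ := fun a =>
    ∑ j ∈ Finset.range a, (f (j + 1) (n - 1 - j) 0 - f j (n - 1 - j) 1)
  let g₂ : ℕ → ℤ := fun b => f (n - 1 - b) b 1 - g₁ (n - 1 - b)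
  let r : ℕ → ℕ → ℕ → ℤ := fun a b c => f a b c - g₁ a - g₂ b
  have hr0 : ∀ a b, a + b + 1 = n → r (a + 1) b 0 = 0 := by
    intro a b hab
    have e1 : n - 1 - a = b := by omega
    have e2 : n - 1 - b = a := by omega
    simp only [r, g₂, e2]
    simp only [g₁, Finset.sum_range_succ, e1]
    ring
  have hr1 : ∀ a b, a + b + 1 = n → r a b 1 = 0 := by
    intro a b hab
    have e2 : n - 1 - b = a := by omega
    simp only [r, g₂, e2]
    ring
  have hrow : ∀ c a b, a + b + c + 1 = n → (c = 0 → b ≠ 0 ∧ a ≠ 0) →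
      M ∣ r (a + 1) b c - r a (b + 1) c := by
    intro c
    induction c using Nat.twoStepInduction with
    | zero =>
      intro a b hab h0
      obtain ⟨a, rfl⟩ := Nat.exists_eq_succ_of_ne_zero (h0 rfl).2
      rw [hr0 _ _ (by omega), hr0 _ _ (by omega), sub_zero]
      exact dvd_zero _
    | one =>
      intro a b hab _
      rw [hr1 _ _ (by omega), hr1 _ _ (by omega), sub_zero]
      exact dvd_zero _
    | more c h1 h2 =>
      intro a b hab _
      have k1 := h1 (a + 1) (b + 1) (by omega) (by omega)
      have k2 := h2 a (b + 1) (by omega) (by omega)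
      have k3 := h2 (a + 1) b (by omega) (by omega)
      have k4 := hf a b c (by omega)
      have k5 := dvd_add (dvd_sub (dvd_add k2 k3) k1) (dvd_neg.2 k4)
      refine k5.trans (dvd_of_eq ?_)
      simp only [r]
      ring
  have hconst : ∀ c, c ≠ 0 → ∀ a b, a + b + c = n → M ∣ r a b c - r 0 (a + b) c := by
    intro c hc a
    induction a with
    | zero => simp
    | succ a ih =>
      intro b hab
      have k1 := hrow c a b (by omega) (fun h0 => absurd h0 hc)
      have k2 := ih (b + 1) (by omega)
      have k3 := dvd_add k1 k2
      rw [sub_add_sub_cancel, show a + (b + 1) = a + 1 + b by omega] at k3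
      exact k3
  refine ⟨g₁, g₂, fun c => if c = 0 then 0 else r 0 (n - c) c, ?_⟩
  intro a b c habc ha hb hc
  by_cases h0 : c = 0
  · subst h0
    obtain ⟨a, rfl⟩ := Nat.exists_eq_succ_of_ne_zero (show a ≠ 0 by omega)
    have := hr0 a b (by omega)
    simp only [r] at this
    simp only [if_true]
    rw [add_zero, ← sub_sub, this]
    exact dvd_zero _
  · have := hconst c h0 a b habc
    simp only [if_neg h0]
    rw [show n - c = a + b by omega]
    refine this.trans (dvd_of_eq ?_)
    simp only [r]
    ring

namespace TriVertex

variable {n : ℕ}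

theorem exists_sum_of_flux {M : ℤ} (κ : TriVertex n → ℤ)
    (hκ : ∀ y : TriVertex n, (∀ c, y.1 c ≠ 0) → 2 * M ∣ flux κ y) :
    ∃ g : Fin 3 → ℕ → ℤ, ∀ x : TriVertex n, M ∣ κ x - ∑ c, g c (x.1 c) := by
  obtain ⟨g₁, g₂, g₃, hg⟩ := exists_sum_of_hexagon (n := n) (M := M) (val κ 0) (by
    intro a b c habc
    have hv : ∑ k, coords 0 (a + 1) (b + 1) (c + 1) k = n ∧
        ∀ k, coords 0 (a + 1) (b + 1) (c + 1) k ≠ n := by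
      rw [isVertex_coords]; omega
    have h1 := hκ ⟨_, hv⟩ (by
      show ∀ k, coords 0 (a + 1) (b + 1) (c + 1) k ≠ 0
      rw [forall_rotate 0, coords_zero, coords_one, coords_two]; omega)
    rw [flux_interior κ 0 a b c _ rfl] at h1
    exact Int.dvd_of_mul_dvd_mul_left two_ne_zero h1)
  refine ⟨![g₁, g₂, g₃], fun x => ?_⟩
  have hx := x.2.1
  rw [Fin.sum_univ_three] at hx
  have h1 := hg (x.1 0) (x.1 1) (x.1 2) hx (x.2.2 0) (x.2.2 1) (x.2.2 2)
  have h2 : val κ 0 (x.1 0) (x.1 1) (x.1 2) = κ x := by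
    have e : coords 0 (x.1 0) (x.1 1) (x.1 2) = x.1 :=
      ((eq_coords_iff x.1 0 _ _ _).2 ⟨rfl, rfl, rfl⟩).symm
    rw [val, e, extend_coe]
  rw [h2] at h1
  rw [Fin.sum_univ_three]
  exact h1

/-- Congruence to a sum of functions of one coordinate, in rotated coordinates. -/
theorem dvd_val_sub {M : ℤ} {κ : TriVertex n → ℤ} {g : Fin 3 → ℕ → ℤ}
    (hg : ∀ x : TriVertex n, M ∣ κ x - ∑ c, g c (x.1 c)) (i : Fin 3) {a b c : ℕ}
    (hsum : a + b + c = n) (ha : a ≠ n) (hb : b ≠ n) (hc : c ≠ n) :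
    M ∣ val κ i a b c - (g i a + g (i + 1) b + g (i + 2) c) := by
  have hv := (isVertex_coords (n := n) i).2 ⟨hsum, ha, hb, hc⟩
  have h1 := hg ⟨_, hv⟩
  rw [sum_eq_rotate _ i] at h1
  rw [val_eq κ i hv]
  simpa only [coords_zero, coords_one, coords_two] using h1

/-- If a sum of functions of one coordinate vanishes modulo `M`, these are affine modulo `M`. -/
theorem dvd_secondDiff {M : ℤ} {g : Fin 3 → ℕ → ℤ}
    (hg : ∀ x : TriVertex n, M ∣ ∑ c, g c (x.1 c)) (i : Fin 3) {x : ℕ} (hx : x + 3 ≤ n) :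
    M ∣ secondDiff (g i) x := by
  have hg' : ∀ x : TriVertex n, M ∣ (0 : TriVertex n → ℤ) x - ∑ c, g c (x.1 c) := by
    intro x
    simpa using hg x
  obtain ⟨c, rfl⟩ : ∃ c, n = x + 3 + c := ⟨n - (x + 3), by omega⟩
  have hz : ∀ a b c', val (0 : TriVertex (x + 3 + c) → ℤ) i a b c' = 0 := by
    intro a b c'
    simp only [val, extend]
    split_ifs <;> rfl
  have k1 := dvd_val_sub hg' i (a := x + 2) (b := 0) (c := c + 1) (by omega) (by omega) (by omega)
    (by omega)
  have k2 := dvd_val_sub hg' i (a := x + 1) (b := 1) (c := c + 1) (by omega) (by omega) (by omega)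
    (by omega)
  have k3 := dvd_val_sub hg' i (a := x + 1) (b := 0) (c := c + 2) (by omega) (by omega) (by omega)
    (by omega)
  have k4 := dvd_val_sub hg' i (a := x) (b := 1) (c := c + 2) (by omega) (by omega) (by omega)
    (by omega)
  rw [hz] at k1 k2 k3 k4
  have k5 := dvd_sub (dvd_sub k2 k1) (dvd_sub k4 k3)
  refine k5.trans (dvd_of_eq ?_)
  simp only [secondDiff]
  ring

end TriVertex

/-! ### Gluing of small vertices -/

namespace TriVertex

variable {n : ℕ}

theorem toTriangle_eq_zero (x : TriVertex n) (c : Fin 3) : x.toTriangle.1 c = 0 ↔ x.1 c = 0 := by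
  have hn : (n : ℝ) ≠ 0 := Nat.cast_ne_zero.2 x.n_ne_zero
  simp [toTriangle, hn]

theorem toTriangle_eq_iff (x y : TriVertex n) (c d : Fin 3) :
    x.toTriangle.1 c = y.toTriangle.1 d ↔ x.1 c = y.1 d := by
  have hn : (n : ℝ) ≠ 0 := Nat.cast_ne_zero.2 x.n_ne_zero
  simp only [toTriangle]
  rw [div_left_inj' hn, Nat.cast_inj]

theorem toTriangle_injective : Function.Injective (toTriangle (n := n)) := fun x y hxy =>
  Subtype.ext (funext fun c => (toTriangle_eq_iff x y c c).1 (by rw [hxy]))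

theorem toTriangle_ne_one (x : TriVertex n) (c : Fin 3) : x.toTriangle.1 c ≠ 1 := by
  have hn : (n : ℝ) ≠ 0 := Nat.cast_ne_zero.2 x.n_ne_zero
  simp only [toTriangle]
  rw [Ne, div_eq_one_iff_eq hn, Nat.cast_inj]
  exact x.2.2 c

theorem sum_rotate (x : TriVertex n) (i : Fin 3) : x.1 i + x.1 (i + 1) + x.1 (i + 2) = n := by
  rw [← sum_eq_rotate, x.2.1]

theorem eq_of_rotate {x y : TriVertex n} (i : Fin 3) (h0 : x.1 i = y.1 i)
    (h1 : x.1 (i + 1) = y.1 (i + 1)) : x = y := by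
  refine Subtype.ext (funext ((forall_rotate i).2 ⟨h0, h1, ?_⟩))
  have := x.sum_rotate i
  have := y.sum_rotate i
  omega

end TriVertex

namespace IdealTriangulation

open TriVertex

variable {S : Type*} [TopologicalSpace S] {F : Type*} [Fintype F] (T : IdealTriangulation S F)
  (n : ℕ)

theorem edgeGlued_symm {a b : F × Triangle} (hab : EdgeGlued T.glue a b) :
    EdgeGlued T.glue b a := by
  obtain ⟨i, j, hg, h1, h2, h3, h4⟩ := hab
  exact ⟨j, i, by rw [← hg, T.glue_glue], h2, h1, h4.symm, h3.symm⟩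

/-- A point of a triangle other than a corner lies on at most one edge, so it is glued to at most one
other point. -/
theorem eq_of_edgeGlued_of_edgeGlued {a b c : F × Triangle} (hb : ∀ k, b.2.1 k ≠ 1)
    (hab : EdgeGlued T.glue a b) (hbc : EdgeGlued T.glue b c) : a = c := by
  obtain ⟨i, j, hg, h1, h2, h3, h4⟩ := hab
  obtain ⟨j', k, hg', h1', h2', h3', h4'⟩ := hbc
  have hj : j' = j := by
    have hs := b.2.2.2
    have e0 := hb 0
    have e1 := hb 1
    have e2 := hb 2
    rw [Fin.sum_univ_three] at hs
    by_contra hne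
    fin_cases j <;> fin_cases j' <;> simp_all
  subst hj
  have hg'' : (a.1, i) = (c.1, k) := by rw [← hg', ← hg, T.glue_glue]
  obtain ⟨e1, rfl⟩ := Prod.ext_iff.1 hg''
  refine Prod.ext e1 (Subtype.ext (funext ((forall_rotate i).2 ⟨?_, ?_, ?_⟩)))
  · exact h3.symm.trans h4'.symm
  · exact h4.symm.trans h3'.symm
  · exact h1.trans h2'.symm

theorem ne_one_of_edgeGlued {a b : F × Triangle} (hab : EdgeGlued T.glue a b)
    (ha : ∀ k, a.2.1 k ≠ 1) (k : Fin 3) : b.2.1 k ≠ 1 := by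
  obtain ⟨i, j, hg, h1, h2, h3, h4⟩ := hab
  revert k
  rw [forall_rotate j, h2, h3, h4]
  exact ⟨ha _, ha _, zero_ne_one⟩

theorem eq_or_edgeGlued {a b : F × Triangle} (hab : Relation.EqvGen (EdgeGlued T.glue) a b) :
    ((∀ k, a.2.1 k ≠ 1) ↔ ∀ k, b.2.1 k ≠ 1) ∧
      ((∀ k, a.2.1 k ≠ 1) → a = b ∨ EdgeGlued T.glue a b) := by
  induction hab with
  | rel a b hab =>
    exact ⟨⟨T.ne_one_of_edgeGlued hab, T.ne_one_of_edgeGlued (T.edgeGlued_symm hab)⟩,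
      fun _ => Or.inr hab⟩
  | refl a => exact ⟨Iff.rfl, fun _ => Or.inl rfl⟩
  | symm a b _ ih =>
    refine ⟨ih.1.symm, fun hb => ?_⟩
    rcases ih.2 (ih.1.2 hb) with h1 | h1
    · exact Or.inl h1.symm
    · exact Or.inr (T.edgeGlued_symm h1)
  | trans a b c _ _ ih1 ih2 =>
    refine ⟨ih1.1.trans ih2.1, fun ha => ?_⟩
    have hb := ih1.1.1 ha
    rcases ih1.2 ha with rfl | h1
    · exact ih2.2 ha
    · rcases ih2.2 hb with rfl | h2
      · exact Or.inr h1
      · exact Or.inl (T.eq_of_edgeGlued_of_edgeGlued hb h1 h2)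

/-- Small vertices of two faces coincide on the surface only if they are the same or lie at
corresponding places of a pair of glued edges. -/
theorem vert_eq_vert_iff {τ τ' : F} {x x' : TriVertex n} :
    T.vert n τ x = T.vert n τ' x' ↔ (τ = τ' ∧ x = x') ∨
      ∃ i j, T.glue (τ, i) = (τ', j) ∧ x.1 (i + 2) = 0 ∧ x'.1 (j + 2) = 0 ∧
        x'.1 (j + 1) = x.1 i ∧ x'.1 j = x.1 (i + 1) := by
  have h1 : T.vert n τ x = T.vert n τ' x' ↔
      Relation.EqvGen (EdgeGlued T.glue) (τ, x.toTriangle) (τ', x'.toTriangle) := by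
    rw [← T.char_eq_char_iff]
    exact Subtype.ext_iff
  have h2 : EdgeGlued T.glue (τ, x.toTriangle) (τ', x'.toTriangle) ↔
      ∃ i j, T.glue (τ, i) = (τ', j) ∧ x.1 (i + 2) = 0 ∧ x'.1 (j + 2) = 0 ∧
        x'.1 (j + 1) = x.1 i ∧ x'.1 j = x.1 (i + 1) := by
    simp only [EdgeGlued, toTriangle_eq_zero, toTriangle_eq_iff]
  rw [h1, ← h2]
  constructor
  · intro h3
    rcases (T.eq_or_edgeGlued h3).2 x.toTriangle_ne_one with h4 | h4
    · exact Or.inl ⟨(Prod.ext_iff.1 h4).1, toTriangle_injective (Prod.ext_iff.1 h4).2⟩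
    · exact Or.inr h4
  · rintro (⟨rfl, rfl⟩ | h3)
    · exact Relation.EqvGen.refl _
    · exact Relation.EqvGen.rel _ _ h3

theorem exists_vert_eq (v : T.SmallVertex n) : ∃ τ x, T.vert n τ x = v := by
  obtain ⟨_, ⟨⟨τ, x⟩, rfl⟩⟩ := v
  exact ⟨τ, x, rfl⟩

/-- A small vertex on an edge has a twin on the glued edge. -/
theorem vert_coords_eq {τ τ' : F} {i j : Fin 3} (hg : T.glue (τ, i) = (τ', j)) {a b : ℕ}
    {x x' : TriVertex n} (hx : x.1 = coords i a b 0) (hx' : x'.1 = coords j b a 0) :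
    T.vert n τ x = T.vert n τ' x' := by
  rw [T.vert_eq_vert_iff]
  refine Or.inr ⟨i, j, hg, ?_⟩
  rw [hx, hx']
  simp only [coords_zero, coords_one, coords_two, and_self]

/-! ### The flux of a vector -/

variable {n}

/-- The pullback of a vector to a face. -/
def pull (k : T.SmallVertex n → ℤ) (τ : F) : TriVertex n → ℤ := fun x => k (T.vert n τ x)

/-- The vector `2 k Q_λ`. -/
def flux (k : T.SmallVertex n → ℤ) (v : T.SmallVertex n) : ℤ := ∑ u, k u * T.doubledQ n u v

open Classical in
theorem flux_eq_sum (k : T.SmallVertex n → ℤ) (v : T.SmallVertex n) :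
    T.flux k v = ∑ a : F × TriVertex n,
      if T.vert n a.1 a.2 = v then TriVertex.flux (T.pull k a.1) a.2 else 0 := by
  rw [Fintype.sum_prod_type]
  simp only [flux, doubledQ, Finset.mul_sum]
  rw [Finset.sum_comm]
  refine Finset.sum_congr rfl fun τ _ => ?_
  rw [Finset.sum_comm]
  simp only [Finset.sum_comm (s := (Finset.univ : Finset (T.SmallVertex n)))]
  rw [Finset.sum_comm]
  refine Finset.sum_congr rfl fun y _ => ?_
  split_ifs with h1
  · refine Finset.sum_congr rfl fun x _ => ?_
    simp [h1, pull]
  · simp [h1]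

theorem flux_interior {τ : F} {y : TriVertex n} (k : T.SmallVertex n → ℤ)
    (hy : ∀ c, y.1 c ≠ 0) : T.flux k (T.vert n τ y) = TriVertex.flux (T.pull k τ) y := by
  classical
  rw [flux_eq_sum, Finset.sum_eq_single (τ, y)]
  · simp
  · rintro ⟨τ', y'⟩ _ hne
    rw [if_neg]
    intro h1
    rcases (T.vert_eq_vert_iff n).1 h1.symm with ⟨rfl, rfl⟩ | ⟨i, j, -, h2, -⟩
    · exact hne rfl
    · exact hy _ h2
  · exact fun h1 => absurd (Finset.mem_univ _) h1

theorem val_pull_glue (k : T.SmallVertex n → ℤ) {τ τ' : F} {i j : Fin 3}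
    (hg : T.glue (τ, i) = (τ', j)) (a b : ℕ) :
    val (T.pull k τ) i a b 0 = val (T.pull k τ') j b a 0 := by
  by_cases h1 : a + b + 0 = n ∧ a ≠ n ∧ b ≠ n ∧ 0 ≠ n
  · have hv := (isVertex_coords (n := n) i).2 h1
    have hv' := (isVertex_coords (n := n) j (a := b) (b := a) (c := 0)).2 (by omega)
    rw [val_eq _ i hv, val_eq _ j hv', pull, pull,
      T.vert_coords_eq n hg (x := ⟨_, hv⟩) (x' := ⟨_, hv'⟩) rfl rfl]
  · rw [val_eq_zero _ i h1, val_eq_zero _ j (by omega)]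

/-- At an inner vertex of an ideal arc the contributions of the boundary arrows of the two adjacent
faces cancel. -/
theorem flux_edge (k : T.SmallVertex n → ℤ) {τ τ' : F} {i j : Fin 3}
    (hg : T.glue (τ, i) = (τ', j)) {a b : ℕ} {y : TriVertex n}
    (hy : y.1 = coords i (a + 1) (b + 1) 0) :
    T.flux k (T.vert n τ y) = 2 *
      (val (T.pull k τ) i a (b + 1) 1 - val (T.pull k τ) i (a + 1) b 1 +
        (val (T.pull k τ') j b (a + 1) 1 - val (T.pull k τ') j (b + 1) a 1)) := by
  classical
  have hv := y.2
  rw [hy, isVertex_coords] at hv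
  have hv' := (isVertex_coords (n := n) j (a := b + 1) (b := a + 1) (c := 0)).2 (by omega)
  let y' : TriVertex n := ⟨_, hv'⟩
  have hy' : y'.1 = coords j (b + 1) (a + 1) 0 := rfl
  have hvert : T.vert n τ y = T.vert n τ' y' := T.vert_coords_eq n hg hy hy'
  have hne : (τ, y) ≠ (τ', y') := by
    intro h1
    have h2 := T.glue_fst_ne (τ, i)
    rw [hg] at h2
    exact h2 (Prod.ext_iff.1 h1).1.symm
  rw [flux_eq_sum, ← Finset.sum_subset (Finset.subset_univ {(τ, y), (τ', y')}),
    Finset.sum_pair hne]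
  · rw [if_pos rfl, if_pos hvert.symm, TriVertex.flux_edge _ i a b y hy,
      TriVertex.flux_edge _ j b a y' hy', T.val_pull_glue k hg, T.val_pull_glue k hg]
    ring
  · rintro ⟨σ, z⟩ _ hz
    rw [if_neg]
    intro h1
    rw [Finset.mem_insert, Finset.mem_singleton, not_or] at hz
    rcases (T.vert_eq_vert_iff n).1 h1.symm with ⟨rfl, rfl⟩ | ⟨i', j', hg', h2, h3, h4, h5⟩
    · exact hz.1 rfl
    · have hi : i' = i := by
        have : ∀ c, y.1 (c + 2) = 0 → c = i := by
          rw [forall_rotate i, add_right_comm, hy, coords_two]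
          have e1 : i + 2 + 1 = i := by rw [add_assoc]; exact add_zero i
          have e2 : i + 2 + 2 = i + 1 := by rw [add_assoc]; rfl
          rw [e1, e2, coords_zero, coords_one]
          exact ⟨fun _ => rfl, fun h => absurd h (by omega), fun h => absurd h (by omega)⟩
        exact this i' h2
      subst hi
      rw [hg] at hg'
      obtain ⟨rfl, rfl⟩ := Prod.ext_iff.1 hg'
      refine hz.2 (Prod.ext rfl (eq_of_rotate j ?_ ?_))
      · rw [h5, hy', hy, coords_zero, coords_one]
      · rw [h4, hy', hy, coords_zero, coords_one]

/-- Every small vertex is either in the interior of a face or in the interior of an ideal arc. -/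
theorem vertex_cases {P : T.SmallVertex n → Prop}
    (hint : ∀ τ y, (∀ c, y.1 c ≠ 0) → P (T.vert n τ y))
    (hedge : ∀ (τ : F) (i : Fin 3) (a b : ℕ) (y : TriVertex n), a + b + 2 = n →
      y.1 = coords i (a + 1) (b + 1) 0 → P (T.vert n τ y)) (v : T.SmallVertex n) : P v := by
  obtain ⟨τ, y, rfl⟩ := T.exists_vert_eq n v
  by_cases hy : ∀ c, y.1 c ≠ 0
  · exact hint τ y hy
  · push Not at hy
    obtain ⟨c, hc⟩ := hy
    obtain ⟨i, rfl⟩ : ∃ i : Fin 3, c = i + 2 := ⟨c + 1, by rw [add_assoc]; exact (add_zero c).symm⟩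
    have hs := y.sum_rotate i
    have h0 := y.2.2 i
    have h1 := y.2.2 (i + 1)
    refine hedge τ i (y.1 i - 1) (y.1 (i + 1) - 1) y (by omega) ?_
    rw [eq_coords_iff]
    omega

/-- `k` is modulo `M` on every face `τ` the sum of the functions `g τ c` of the barycentric coordinates
at the corners `c`. -/
def IsCornerSum (M : ℤ) (k : T.SmallVertex n → ℤ) (g : F → Fin 3 → ℕ → ℤ) : Prop :=
  ∀ τ (x : TriVertex n), M ∣ T.pull k τ x - ∑ c, g τ c (x.1 c)

variable {T} {M : ℤ} {k : T.SmallVertex n → ℤ} {g : F → Fin 3 → ℕ → ℤ}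

theorem exists_isCornerSum (hk : ∀ v, 2 * M ∣ T.flux k v) : ∃ g, T.IsCornerSum M k g := by
  choose g hg using fun τ => exists_sum_of_flux (M := M) (T.pull k τ) fun y hy => by
    rw [← T.flux_interior k hy]
    exact hk _
  exact ⟨g, hg⟩

theorem IsCornerSum.dvd_edge_val (hg : T.IsCornerSum M k g) {τ τ' : F} {i j : Fin 3}
    (hglue : T.glue (τ, i) = (τ', j)) {a b : ℕ} (hab : a + b = n) (ha : a ≠ 0) (hb : b ≠ 0) :
    M ∣ (g τ i a + g τ (i + 1) b + g τ (i + 2) 0) -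
      (g τ' j b + g τ' (j + 1) a + g τ' (j + 2) 0) := by
  have h1 := dvd_val_sub (hg τ) i (a := a) (b := b) (c := 0) (by omega) (by omega) (by omega)
    (by omega)
  have h2 := dvd_val_sub (hg τ') j (a := b) (b := a) (c := 0) (by omega) (by omega) (by omega)
    (by omega)
  rw [T.val_pull_glue k hglue] at h1
  exact (dvd_sub h2 h1).trans (dvd_of_eq (by ring))

/-- The vanishing of the flux modulo `2 M` across an ideal arc, in terms of corner functions. -/
theorem IsCornerSum.dvd_flux_edge_iff (hg : T.IsCornerSum M k g) {τ τ' : F} {i j : Fin 3}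
    (hglue : T.glue (τ, i) = (τ', j)) {a b : ℕ} (hab : a + b + 2 = n) {y : TriVertex n}
    (hy : y.1 = coords i (a + 1) (b + 1) 0) :
    2 * M ∣ T.flux k (T.vert n τ y) ↔
      M ∣ (g τ (i + 1) (b + 1) - g τ (i + 1) b) - (g τ i (a + 1) - g τ i a) +
        ((g τ' (j + 1) (a + 1) - g τ' (j + 1) a) - (g τ' j (b + 1) - g τ' j b)) := by
  have h1 := dvd_val_sub (hg τ) i (a := a) (b := b + 1) (c := 1) (by omega) (by omega) (by omega)
    (by omega)
  have h2 := dvd_val_sub (hg τ) i (a := a + 1) (b := b) (c := 1) (by omega) (by omega) (by omega)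
    (by omega)
  have h3 := dvd_val_sub (hg τ') j (a := b) (b := a + 1) (c := 1) (by omega) (by omega) (by omega)
    (by omega)
  have h4 := dvd_val_sub (hg τ') j (a := b + 1) (b := a) (c := 1) (by omega) (by omega) (by omega)
    (by omega)
  rw [T.flux_edge k hglue hy, mul_dvd_mul_iff_left two_ne_zero]
  refine dvd_iff_dvd_of_dvd_sub ((dvd_add (dvd_sub h1 h2) (dvd_sub h3 h4)).trans (dvd_of_eq ?_))
  ring

theorem IsCornerSum.dvd_flux (hg : T.IsCornerSum M k g)
    (hedge : ∀ τ i τ' j, T.glue (τ, i) = (τ', j) → ∀ a b, a + b + 2 = n →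
      M ∣ (g τ (i + 1) (b + 1) - g τ (i + 1) b) - (g τ i (a + 1) - g τ i a) +
        ((g τ' (j + 1) (a + 1) - g τ' (j + 1) a) - (g τ' j (b + 1) - g τ' j b))) :
    ∀ v, 2 * M ∣ T.flux k v := by
  refine T.vertex_cases ?_ ?_
  · intro τ y hy
    rw [T.flux_interior k hy]
    obtain ⟨a, ha⟩ := Nat.exists_eq_succ_of_ne_zero (hy 0)
    obtain ⟨b, hb⟩ := Nat.exists_eq_succ_of_ne_zero (hy 1)
    obtain ⟨c, hc⟩ := Nat.exists_eq_succ_of_ne_zero (hy 2)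
    have hs := y.sum_rotate 0
    simp only [zero_add] at hs
    rw [TriVertex.flux_interior _ 0 a b c y ((eq_coords_iff _ 0 _ _ _).2 ⟨ha, hb, hc⟩)]
    have key : ∀ a b c, a + b + c = n → a ≠ n → b ≠ n → c ≠ n →
        M ∣ val (T.pull k τ) 0 a b c - (g τ 0 a + g τ (0 + 1) b + g τ (0 + 2) c) :=
      fun a b c hsum ha hb hc => dvd_val_sub (hg τ) 0 hsum ha hb hc
    have h1 := key (a + 2) b (c + 1) (by omega) (by omega) (by omega) (by omega)
    have h2 := key a (b + 2) (c + 1) (by omega) (by omega) (by omega) (by omega)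
    have h3 := key (a + 1) (b + 2) c (by omega) (by omega) (by omega) (by omega)
    have h4 := key (a + 1) b (c + 2) (by omega) (by omega) (by omega) (by omega)
    have h5 := key a (b + 1) (c + 2) (by omega) (by omega) (by omega) (by omega)
    have h6 := key (a + 2) (b + 1) c (by omega) (by omega) (by omega) (by omega)
    refine mul_dvd_mul_left 2 ((dvd_add (dvd_add (dvd_sub h1 h2) (dvd_sub h3 h4))
      (dvd_sub h5 h6)).trans (dvd_of_eq ?_))
    ring
  · intro τ i a b y hab hy
    rw [hg.dvd_flux_edge_iff (τ' := (T.glue (τ, i)).1) (j := (T.glue (τ, i)).2) rfl hab hy]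
    exact hedge _ _ _ _ rfl _ _ hab

/-- Across an ideal arc the second differences of the corner functions of a vector with vanishing flux
agree. -/
theorem IsCornerSum.dvd_secondDiff_sub (hg : T.IsCornerSum M k g) (hk : ∀ v, 2 * M ∣ T.flux k v)
    {τ τ' : F} {i j : Fin 3} (hglue : T.glue (τ, i) = (τ', j)) {x : ℕ} (hx : x + 3 ≤ n) :
    M ∣ secondDiff (g τ i) x - secondDiff (g τ' (j + 1)) x := by
  obtain ⟨b, rfl⟩ : ∃ b, n = x + 3 + b := ⟨n - (x + 3), by omega⟩
  have hv := (isVertex_coords (n := x + 3 + b) i (a := x + 1) (b := b + 2) (c := 0)).2 (by omega)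
  have h1 := (hg.dvd_flux_edge_iff hglue (a := x) (b := b + 1) (by omega) (y := ⟨_, hv⟩) rfl).1
    (hk _)
  have h2 := hg.dvd_edge_val hglue (a := x + 1) (b := b + 2) (by omega) (by omega) (by omega)
  have h3 := hg.dvd_edge_val hglue (a := x + 2) (b := b + 1) (by omega) (by omega) (by omega)
  refine (dvd_add h1 (dvd_sub h3 h2)).trans (dvd_of_eq ?_)
  simp only [secondDiff]
  ring

end IdealTriangulation

/-! ### Balanced vectors and puncture vectors -/

/-- Balanced vectors of a triangle are those that are modulo `n` a linear combination of the three
barycentric coordinates. -/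
theorem mem_balancedTriangle_iff {n : ℕ} {κ : TriVertex n → ℤ} :
    κ ∈ balancedTriangle n ↔ ∃ α : Fin 3 → ℤ, ∀ x, (n : ℤ) ∣ κ x - ∑ c, α c * x.1 c := by
  constructor
  · intro h
    induction h using AddSubgroup.closure_induction with
    | mem κ hκ =>
      rcases hκ with ⟨c, rfl⟩ | hκ
      · refine ⟨Pi.single c 1, fun x => ?_⟩
        simp [Pi.single_apply]
      · exact ⟨0, fun x => by simpa using hκ x⟩
    | zero => exact ⟨0, fun x => by simp⟩
    | add κ κ' _ _ h1 h2 =>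
      obtain ⟨α, hα⟩ := h1
      obtain ⟨α', hα'⟩ := h2
      refine ⟨α + α', fun x => (dvd_add (hα x) (hα' x)).trans (dvd_of_eq ?_)⟩
      simp only [Pi.add_apply, add_mul, Finset.sum_add_distrib]
      ring
    | neg κ _ h1 =>
      obtain ⟨α, hα⟩ := h1
      refine ⟨-α, fun x => ((dvd_neg).2 (hα x)).trans (dvd_of_eq ?_)⟩
      simp only [Pi.neg_apply, neg_mul, Finset.sum_neg_distrib]
      ring
  · rintro ⟨α, hα⟩
    have h1 : κ = (∑ c, α c • fun x : TriVertex n => (x.1 c : ℤ)) +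
        fun x => κ x - ∑ c, α c * x.1 c := by
      funext x
      simp
    rw [h1]
    refine AddSubgroup.add_mem _ (AddSubgroup.sum_mem _ fun c _ => AddSubgroup.zsmul_mem _ ?_ _) ?_
    · exact AddSubgroup.subset_closure (Or.inl ⟨c, rfl⟩)
    · exact AddSubgroup.subset_closure (Or.inr hα)

/-- If an affine function vanishes modulo `n` at all small vertices, so does its constant term. -/
theorem TriVertex.dvd_constant {n : ℕ} (hn : 2 ≤ n) {C : ℤ} {α : Fin 3 → ℤ}
    (h : ∀ x : TriVertex n, (n : ℤ) ∣ C + ∑ c, α c * x.1 c) : (n : ℤ) ∣ C := by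
  obtain ⟨r, rfl⟩ : ∃ r, n = r + 1 := ⟨n - 1, by omega⟩
  -- the values at the vertices next to the corners give `2 C` and `3 C`
  have key : ∀ i a b, a + b = r + 1 → a ≠ 0 → b ≠ 0 →
      ((r + 1 : ℕ) : ℤ) ∣ C + (α i * a + α (i + 1) * b) := by
    intro i a b hab ha hb
    have hv := (isVertex_coords (n := r + 1) i (a := a) (b := b) (c := 0)).2 (by omega)
    have h1 := h ⟨_, hv⟩
    rw [sum_eq_rotate _ i] at h1
    simpa only [coords_zero, coords_one, coords_two, Nat.cast_zero, mul_zero, add_zero] using h1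
  have h0 := key 0 1 r (by omega) (by omega) (by omega)
  have h0' := key 0 r 1 (by omega) (by omega) (by omega)
  have h1 := key 1 1 r (by omega) (by omega) (by omega)
  have h2 := key 2 1 r (by omega) (by omega) (by omega)
  have e1 : (1 : Fin 3) + 1 = 2 := rfl
  have e2 : (2 : Fin 3) + 1 = 0 := rfl
  rw [e1] at h1
  rw [e2] at h2
  rw [zero_add] at h0 h0'
  have h3 := dvd_sub (dvd_add (dvd_add h0 h1) h2) (dvd_add h0 h0')
  have h4 : ((r + 1 : ℕ) : ℤ) ∣ ((r + 1 : ℕ) : ℤ) * (α 2) := dvd_mul_right _ _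
  refine (dvd_sub h3 h4).trans (dvd_of_eq ?_)
  push_cast
  ring

/-- The function of the barycentric coordinate at a corner that describes the vector `b(λ, p, i)` near
the puncture `p`: it is linear up to `i` and then changes its slope by `-n`. The subtraction `x - i` is
truncated. -/
def cornerB (n i x : ℕ) : ℤ := ((n : ℤ) - i) * x - n * ((x - i : ℕ) : ℤ)

theorem secondDiff_cornerB (n i x : ℕ) :
    secondDiff (cornerB n i) x = if i = x + 1 then -(n : ℤ) else 0 := by
  simp only [secondDiff, cornerB]
  split_ifs with h
  · subst h
    rw [show x + 2 - (x + 1) = 1 by omega, Nat.sub_self, show x - (x + 1) = 0 by omega]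
    push_cast
    ring
  · rcases Nat.lt_or_ge x i with h1 | h1
    · rw [show x + 2 - i = 0 by omega, show x + 1 - i = 0 by omega, show x - i = 0 by omega]
      push_cast
      ring
    · rw [Nat.cast_sub h1, Nat.cast_sub (by omega), Nat.cast_sub (by omega)]
      push_cast
      ring

theorem cornerB_last {n x : ℕ} (hx : x + 1 ≤ n) : cornerB n (n - 1) x = x := by
  rw [cornerB, show x - (n - 1) = 0 by omega, Nat.cast_sub (by omega)]
  push_cast
  ring

namespace IdealTriangulation

open TriVertex

variable {S : Type*} [TopologicalSpace S] {F : Type*} [Fintype F] (T : IdealTriangulation S F)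
  {n : ℕ}

open Classical in
theorem b_vert (p : S) (i : ℕ) (τ : F) (x : TriVertex n) :
    T.b n p i (T.vert n τ x) =
      ∑ c, if T.char τ (Triangle.corner c) = p then cornerB n i (x.1 c) else 0 := by
  have hn := x.n_ne_zero
  have hx : ∀ c, x.1 c < n := by
    intro c
    have h1 := x.sum_rotate c
    have h2 := x.2.2 c
    omega
  have hsingle : ∀ (f : ℕ → ℤ) (m : ℕ) (c : Fin 3), m ≤ n - 1 →
      ∑ t ∈ Finset.Icc 1 m, f t * (if x.1 c + t = n then 1 else 0) =
        if n ≤ x.1 c + m then f (n - x.1 c) else 0 := by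
    intro f m c hm
    have h1 := hx c
    split_ifs with h2
    · rw [Finset.sum_eq_single (n - x.1 c), if_pos (by omega), mul_one]
      · intro t _ ht
        rw [if_neg (by omega), mul_zero]
      · intro h3
        rw [Finset.mem_Icc] at h3
        omega
    · refine Finset.sum_eq_zero fun t ht => ?_
      rw [Finset.mem_Icc] at ht
      rw [if_neg (by omega), mul_zero]
  have ha : ∀ (f : ℕ → ℤ) (m : ℕ), m ≤ n - 1 →
      ∑ t ∈ Finset.Icc 1 m, f t * T.a n p t (T.vert n τ x) =
        ∑ c, if T.char τ (Triangle.corner c) = p then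
          (if n ≤ x.1 c + m then f (n - x.1 c) else 0) else 0 := by
    intro f m hm
    have h1 : ∀ t ∈ Finset.Icc 1 m, f t * T.a n p t (T.vert n τ x) =
        ∑ c, if T.char τ (Triangle.corner c) = p then
          f t * (if x.1 c + t = n then 1 else 0) else 0 := by
      intro t ht
      rw [Finset.mem_Icc] at ht
      rw [T.a_vert n p (by omega), faceA, Finset.mul_sum]
      refine Finset.sum_congr rfl fun c _ => ?_
      by_cases hc : T.char τ (Triangle.corner c) = p <;> simp [hc]
    rw [Finset.sum_congr rfl h1, Finset.sum_comm]
    refine Finset.sum_congr rfl fun c _ => ?_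
    split_ifs with hc h2
    · rw [hsingle f m c hm, if_pos h2]
    · rw [hsingle f m c hm, if_neg h2]
    · exact Finset.sum_const_zero
  have h1 := ha (fun t => (n : ℤ) * (t + i - n)) (n - i - 1) (by omega)
  have h2 := ha (fun t => (n : ℤ) - t) (n - 1) le_rfl
  simp only [b, Pi.add_apply, Finset.sum_apply, Pi.smul_apply, smul_eq_mul]
  rw [h1, h2, Finset.mul_sum, ← Finset.sum_add_distrib]
  refine Finset.sum_congr rfl fun c _ => ?_
  by_cases hc : T.char τ (Triangle.corner c) = p
  · simp only [hc, if_true, cornerB]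
    have h3 := hx c
    rw [Nat.cast_sub h3.le]
    by_cases h4 : n ≤ x.1 c + (n - i - 1)
    · rw [if_pos h4, if_pos (by omega), Nat.cast_sub (by omega)]
      ring
    · rw [if_neg h4, show x.1 c - i = 0 by omega]
      by_cases h5 : n ≤ x.1 c + (n - 1)
      · rw [if_pos h5]
        push_cast
        ring
      · rw [if_neg h5, show x.1 c = 0 by omega]
        simp
  · simp [hc]

/-! ### Functions on the set of punctures -/

/-- A function on the corners of the faces that is compatible with the gluing modulo `m` descends
modulo `m` to the punctures. -/
theorem exists_puncture_function {m : ℤ} (D : F → Fin 3 → ℤ)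
    (hD : ∀ τ i τ' j, T.glue (τ, i) = (τ', j) → m ∣ D τ i - D τ' (j + 1)) :
    ∃ d : S → ℤ, ∀ τ c, m ∣ D τ c - d (T.char τ (Triangle.corner c)) := by
  classical
  let G : F × Triangle → ℤ := fun a => ∑ c, if a.2.1 c = 1 then D a.1 c else 0
  have hG : ∀ τ c, G (τ, Triangle.corner c) = D τ c := by
    intro τ c
    simp [G, Triangle.corner, Pi.single_apply]
  have hrel : ∀ a b, EdgeGlued T.glue a b → m ∣ G a - G b := by
    rintro ⟨τ, x⟩ ⟨τ', y⟩ ⟨i, j, hg, hx0, hy0, h1, h2⟩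
    have k1 := hD _ _ _ _ hg
    have k2 := hD τ' j τ i (by rw [← hg, T.glue_glue])
    dsimp only at hx0 hy0 h1 h2 k1 k2
    simp only [G]
    rw [sum_eq_rotate _ i, sum_eq_rotate _ j, hx0, hy0, h1, h2,
      if_neg zero_ne_one, if_neg zero_ne_one]
    have k3 : m ∣ (if x.1 i = 1 then D τ i else 0) - (if x.1 i = 1 then D τ' (j + 1) else 0) := by
      split_ifs
      · exact k1
      · simp
    have k4 : m ∣ (if x.1 (i + 1) = 1 then D τ' j else 0) -
        (if x.1 (i + 1) = 1 then D τ (i + 1) else 0) := by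
      split_ifs
      · exact k2
      · simp
    exact (dvd_sub k3 k4).trans (dvd_of_eq (by ring))
  have heqv : ∀ a b, Relation.EqvGen (EdgeGlued T.glue) a b → m ∣ G a - G b := by
    intro a b hab
    induction hab with
    | rel a b h => exact hrel a b h
    | refl a => simp
    | symm a b _ ih => exact (dvd_sub_comm).1 ih
    | trans a b c _ _ ih1 ih2 => exact (dvd_add ih1 ih2).trans (dvd_of_eq (by ring))
  refine ⟨fun p => if hp : ∃ a : F × Fin 3, T.char a.1 (Triangle.corner a.2) = p then
    D hp.choose.1 hp.choose.2 else 0, fun τ c => ?_⟩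
  have hp : ∃ a : F × Fin 3, T.char a.1 (Triangle.corner a.2) = T.char τ (Triangle.corner c) :=
    ⟨(τ, c), rfl⟩
  simp only [dif_pos hp]
  rw [← hG, ← hG]
  exact heqv _ _ ((T.char_eq_char_iff _ _ _ _).1 hp.choose_spec.symm)

variable (n)

/-- The group generated by the vectors `b(λ, p, i)`. -/
def punctureSpan : AddSubgroup (T.SmallVertex n → ℤ) :=
  AddSubgroup.closure {k | ∃ p ∈ T.punctures, ∃ i, 1 ≤ i ∧ i ≤ n - 1 ∧ k = T.b n p i}

open Classical in
/-- The sum of the vectors `b(λ, p, i)` over all punctures `p`, with coefficients `e p`. -/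
def sumB (i : ℕ) (e : S → ℤ) : T.SmallVertex n → ℤ :=
  ∑ p ∈ Finset.univ.image fun a : F × Fin 3 => T.char a.1 (Triangle.corner a.2), e p • T.b n p i

variable {n}

theorem sumB_mem {i : ℕ} (h1 : 1 ≤ i) (h2 : i ≤ n - 1) (e : S → ℤ) :
    T.sumB n i e ∈ T.punctureSpan n := by
  classical
  refine AddSubgroup.sum_mem _ fun p hp => AddSubgroup.zsmul_mem _ ?_ _
  obtain ⟨a, -, ha⟩ := Finset.mem_image.1 hp
  exact AddSubgroup.subset_closure ⟨p, ⟨a, ha⟩, i, h1, h2, rfl⟩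

theorem sumB_vert (i : ℕ) (e : S → ℤ) (τ : F) (x : TriVertex n) :
    T.sumB n i e (T.vert n τ x) =
      ∑ c, e (T.char τ (Triangle.corner c)) * cornerB n i (x.1 c) := by
  classical
  simp only [sumB, Finset.sum_apply, Pi.smul_apply, smul_eq_mul, b_vert, Finset.mul_sum]
  rw [Finset.sum_comm]
  refine Finset.sum_congr rfl fun c _ => ?_
  rw [Finset.sum_eq_single (T.char τ (Triangle.corner c))]
  · simp
  · intro p _ hp
    rw [if_neg hp.symm, mul_zero]
  · intro h
    exact absurd (Finset.mem_image.2 ⟨(τ, c), Finset.mem_univ _, rfl⟩) h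

theorem punctureSpan_le_balanced : T.punctureSpan n ≤ T.balanced n := by
  rw [punctureSpan, AddSubgroup.closure_le]
  rintro _ ⟨p, -, i, -, -, rfl⟩
  exact T.b_mem n p i

theorem flux_add (k l : T.SmallVertex n → ℤ) (v : T.SmallVertex n) :
    T.flux (k + l) v = T.flux k v + T.flux l v := by
  simp only [flux, Pi.add_apply, add_mul, Finset.sum_add_distrib]

theorem flux_neg (k : T.SmallVertex n → ℤ) (v : T.SmallVertex n) :
    T.flux (-k) v = -T.flux k v := by
  simp only [flux, Pi.neg_apply, neg_mul, Finset.sum_neg_distrib]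

theorem flux_nsmul (m : ℕ) (k : T.SmallVertex n → ℤ) (v : T.SmallVertex n) :
    T.flux (m • k) v = m * T.flux k v := by
  simp only [flux, Pi.smul_apply, nsmul_eq_mul, Finset.mul_sum, mul_assoc]

theorem doubledForm_eq (k t : T.SmallVertex n → ℤ) :
    T.doubledForm n k t = ∑ v, T.flux k v * t v := by
  simp only [doubledForm, flux, Finset.sum_mul]
  exact Finset.sum_comm

theorem flux_b (p : S) (i : ℕ) (v : T.SmallVertex n) : T.flux (T.b n p i) v = 0 := by
  classical
  have hg : T.IsCornerSum 0 (T.b n p i) fun τ c y =>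
      if T.char τ (Triangle.corner c) = p then cornerB n i y else 0 := by
    intro τ x
    rw [pull, b_vert, sub_self]
  have h1 := hg.dvd_flux (by
    intro τ i' τ' j hglue a b _
    obtain ⟨e1, e2⟩ := T.char_corner_eq hglue
    simp only [e1, e2]
    refine (dvd_zero _).trans (dvd_of_eq ?_)
    ring) v
  simpa using h1

theorem flux_eq_zero_of_mem_punctureSpan {k : T.SmallVertex n → ℤ} (hk : k ∈ T.punctureSpan n)
    (v : T.SmallVertex n) : T.flux k v = 0 := by
  induction hk using AddSubgroup.closure_induction with
  | mem k hk =>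
    obtain ⟨p, -, i, -, -, rfl⟩ := hk
    exact T.flux_b p i v
  | zero => simp [flux]
  | add k l _ _ h1 h2 => rw [flux_add, h1, h2, add_zero]
  | neg k _ h1 => rw [flux_neg, h1, neg_zero]

theorem mem_balanced_iff {k : T.SmallVertex n → ℤ} : k ∈ T.balanced n ↔
    ∃ α : F → Fin 3 → ℤ, T.IsCornerSum n k fun τ c y => α τ c * y := by
  constructor
  · intro hk
    choose α hα using fun τ => mem_balancedTriangle_iff.1 (hk τ)
    exact ⟨α, hα⟩
  · rintro ⟨α, hα⟩ τ
    exact mem_balancedTriangle_iff.2 ⟨α τ, hα τ⟩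

variable {T}

theorem two_le_of_smallVertex (v : T.SmallVertex n) : 2 ≤ n := by
  obtain ⟨τ, x, -⟩ := T.exists_vert_eq n v
  have h1 := x.sum_rotate 0
  have h2 := x.2.2 0
  have h3 := x.2.2 (0 + 1)
  have h4 := x.2.2 (0 + 2)
  omega

/-- On balanced vectors `k Q_λ` is divisible by `n`. -/
theorem dvd_flux_of_mem_balanced {k : T.SmallVertex n → ℤ} (hk : k ∈ T.balanced n)
    (v : T.SmallVertex n) : 2 * (n : ℤ) ∣ T.flux k v := by
  obtain ⟨α, hα⟩ := T.mem_balanced_iff.1 hk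
  have hn := two_le_of_smallVertex v
  refine hα.dvd_flux ?_ v
  intro τ i τ' j hglue a b _
  have h1 := hα.dvd_edge_val hglue (a := 1) (b := n - 1) (by omega) one_ne_zero (by omega)
  have h2 : (n : ℤ) ∣ n * (α τ (i + 1) - α τ' j) := dvd_mul_right _ _
  refine (dvd_sub h2 h1).trans (dvd_of_eq ?_)
  rw [Nat.cast_sub (by omega)]
  push_cast
  ring

/-! ### Vectors with flux divisible by a multiple of `n` -/

theorem sum_secondDiff_cornerB {n y : ℕ} (hy : y + 3 ≤ n) (e : ℕ → ℤ) :
    ∑ x ∈ Finset.range (n - 2), e x * secondDiff (cornerB n (x + 1)) y = -(n * e y) := by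
  rw [Finset.sum_eq_single y]
  · rw [secondDiff_cornerB, if_pos rfl]
    ring
  · intro x _ hx
    rw [secondDiff_cornerB, if_neg (by omega), mul_zero]
  · intro h
    rw [Finset.mem_range] at h
    omega

/-- A balanced vector with flux divisible by `2 n m` is modulo `n m` linear on every face, up to the
vectors `b(λ, p, i)` with `i ≤ n - 2`: these have the second differences `-n` at `i`, and the second
differences of the corner functions depend only on the puncture and are divisible by `n`. -/
theorem exists_linear {m : ℕ} (hn : 2 ≤ n) {k : T.SmallVertex n → ℤ} (hk : k ∈ T.balanced n)
    (hflux : ∀ v, 2 * ((n : ℤ) * m) ∣ T.flux k v) :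
    ∃ β ∈ T.punctureSpan n, ∃ s : F → Fin 3 → ℤ,
      T.IsCornerSum ((n : ℤ) * m) (k + β) fun τ c y => s τ c * y := by
  obtain ⟨g, hg⟩ := exists_isCornerSum hflux
  obtain ⟨α, hα⟩ := T.mem_balanced_iff.1 hk
  have hd : ∀ x, ∃ d : S → ℤ, x + 3 ≤ n → ∀ τ c,
      (n : ℤ) * m ∣ secondDiff (g τ c) x - d (T.char τ (Triangle.corner c)) := by
    intro x
    by_cases hx : x + 3 ≤ n
    · obtain ⟨d, hd⟩ := T.exists_puncture_function (m := (n : ℤ) * m)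
        (fun τ c => secondDiff (g τ c) x)
        fun τ i τ' j hglue => hg.dvd_secondDiff_sub hflux hglue hx
      exact ⟨d, fun _ => hd⟩
    · exact ⟨0, fun h => absurd h hx⟩
  choose d hd using hd
  -- as `k` is balanced, the second differences are divisible by `n`
  have hdn : ∀ x, x + 3 ≤ n → ∀ τ c, (n : ℤ) ∣ d x (T.char τ (Triangle.corner c)) := by
    intro x hx τ c
    have h1 := dvd_secondDiff (M := (n : ℤ)) (g := fun c y => g τ c y - α τ c * y) (fun y => by
      refine (dvd_sub (hα τ y) ((dvd_mul_right _ _).trans (hg τ y))).trans (dvd_of_eq ?_)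
      rw [Finset.sum_sub_distrib]
      ring) c hx
    refine (dvd_sub h1 ((dvd_mul_right _ _).trans (hd x hx τ c))).trans (dvd_of_eq ?_)
    simp only [secondDiff]
    push_cast
    ring
  let e : ℕ → S → ℤ := fun x p => d x p / n
  let β : T.SmallVertex n → ℤ := ∑ x ∈ Finset.range (n - 2), T.sumB n (x + 1) (e x)
  have hβ : β ∈ T.punctureSpan n := by
    refine AddSubgroup.sum_mem _ fun x hx => T.sumB_mem (by omega) ?_ _
    rw [Finset.mem_range] at hx
    omega
  let g' : F → Fin 3 → ℕ → ℤ := fun τ c y => g τ c y +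
    ∑ x ∈ Finset.range (n - 2), e x (T.char τ (Triangle.corner c)) * cornerB n (x + 1) y
  have hg' : T.IsCornerSum ((n : ℤ) * m) (k + β) g' := by
    intro τ x
    refine (hg τ x).trans (dvd_of_eq ?_)
    simp only [pull, Pi.add_apply, β, Finset.sum_apply, sumB_vert, g', Finset.sum_add_distrib]
    rw [Finset.sum_comm]
    ring
  have hdiff : ∀ τ c y, y + 3 ≤ n → (n : ℤ) * m ∣ secondDiff (g' τ c) y := by
    intro τ c y hy
    refine (hd y hy τ c).trans (dvd_of_eq ?_)
    have h1 := sum_secondDiff_cornerB hy fun x => e x (T.char τ (Triangle.corner c))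
    have h2 : (n : ℤ) * e y (T.char τ (Triangle.corner c)) = d y (T.char τ (Triangle.corner c)) :=
      Int.mul_ediv_cancel' (hdn y hy τ c)
    rw [h2] at h1
    rw [sub_eq_add_neg, ← h1]
    simp only [secondDiff, g', mul_add, mul_sub, Finset.sum_add_distrib, Finset.sum_sub_distrib,
      Finset.mul_sum, mul_left_comm (2 : ℤ)]
    ring
  let C : F → ℤ := fun τ => ∑ c, g' τ c 0
  let s : F → Fin 3 → ℤ := fun τ c => g' τ c 1 - g' τ c 0
  have haff : ∀ τ (x : TriVertex n),
      (n : ℤ) * m ∣ T.pull (k + β) τ x - (C τ + ∑ c, s τ c * x.1 c) := by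
    intro τ x
    have h1 : (n : ℤ) * m ∣ ∑ c, (g' τ c (x.1 c) - (g' τ c 0 + x.1 c * (g' τ c 1 - g' τ c 0))) := by
      refine Finset.dvd_sum fun c _ => dvd_sub_affine_of_secondDiff (hdiff τ c) _ ?_
      have h2 := x.sum_rotate c
      have h3 := x.2.2 c
      omega
    refine (dvd_add (hg' τ x) h1).trans (dvd_of_eq ?_)
    rw [Finset.sum_sub_distrib, Finset.sum_add_distrib, sub_add_sub_cancel]
    simp only [C, s, mul_comm, Finset.sum_add_distrib]
  -- the constant terms are divisible by `n` and can be absorbed, as the coordinates add up to `n`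
  obtain ⟨α', hα'⟩ := T.mem_balanced_iff.1
    (AddSubgroup.add_mem _ hk (T.punctureSpan_le_balanced hβ))
  have hC : ∀ τ, (n : ℤ) ∣ C τ := by
    intro τ
    refine dvd_constant hn (α := fun c => s τ c - α' τ c) fun x => ?_
    refine (dvd_sub (hα' τ x) ((dvd_mul_right _ _).trans (haff τ x))).trans (dvd_of_eq ?_)
    simp only [sub_mul, Finset.sum_sub_distrib]
    ring
  choose C' hC' using hC
  refine ⟨β, hβ, fun τ c => s τ c + C' τ, fun τ x => (haff τ x).trans (dvd_of_eq ?_)⟩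
  have hx : ∑ c, (x.1 c : ℤ) = n := by exact_mod_cast x.2.1
  simp only [add_mul, Finset.sum_add_distrib, ← Finset.mul_sum]
  rw [hx, hC', mul_comm (C' τ)]
  ring

/-- A balanced vector `k` with `k Q_λ` divisible by `n m` is `m` times a balanced vector, up to the
vectors `b(λ, p, i)`. -/
theorem exists_eq_nsmul_add {m : ℕ} (hm : m ≠ 0) {k : T.SmallVertex n → ℤ}
    (hk : k ∈ T.balanced n) (hflux : ∀ v, 2 * ((n : ℤ) * m) ∣ T.flux k v) :
    ∃ l ∈ T.balanced n, ∃ β ∈ T.punctureSpan n, k = m • l + β := by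
  rcases isEmpty_or_nonempty (T.SmallVertex n) with hempty | ⟨⟨v₀⟩⟩
  · exact ⟨0, AddSubgroup.zero_mem _, 0, AddSubgroup.zero_mem _, funext fun v => hempty.elim v⟩
  have hn := two_le_of_smallVertex v₀
  obtain ⟨β, hβ, s, hs⟩ := exists_linear hn hk hflux
  have hflux' : ∀ v, 2 * ((n : ℤ) * m) ∣ T.flux (k + β) v := by
    intro v
    rw [flux_add, T.flux_eq_zero_of_mem_punctureSpan hβ, add_zero]
    exact hflux v
  -- modulo `m` the slopes depend only on the puncture
  obtain ⟨d, hd⟩ := T.exists_puncture_function (m := (m : ℤ)) s (by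
    intro τ i τ' j hglue
    have hv := (isVertex_coords (n := n) i (a := 0 + 1) (b := n - 2 + 1) (c := 0)).2 (by omega)
    have h1 := (hs.dvd_flux_edge_iff hglue (a := 0) (b := n - 2) (by omega) (y := ⟨_, hv⟩) rfl).1
      (hflux' _)
    have h2 := hs.dvd_edge_val hglue (a := 1) (b := n - 1) (by omega) one_ne_zero (by omega)
    have h3 := dvd_sub h2 (h1.mul_left ((n : ℤ) - 1))
    have hn0 : (n : ℤ) ≠ 0 := by exact_mod_cast (by omega : n ≠ 0)
    refine (mul_dvd_mul_iff_left hn0).1 (h3.trans (dvd_of_eq ?_))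
    rw [Nat.cast_sub (by omega)]
    push_cast
    ring)
  choose t ht using hd
  let γ := T.sumB n (n - 1) d
  have hγ : γ ∈ T.punctureSpan n := T.sumB_mem (by omega) le_rfl _
  have hlin : ∀ τ (x : TriVertex n),
      (m : ℤ) * n ∣ (k + β - γ) (T.vert n τ x) - m * ∑ c, t τ c * x.1 c := by
    intro τ x
    rw [mul_comm]
    refine (hs τ x).trans (dvd_of_eq ?_)
    have h1 : γ (T.vert n τ x) = ∑ c, d (T.char τ (Triangle.corner c)) * x.1 c := by
      simp only [γ]
      rw [T.sumB_vert]
      refine Finset.sum_congr rfl fun c _ => ?_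
      rw [cornerB_last]
      have h2 := x.sum_rotate c
      have h3 := x.2.2 c
      omega
    rw [Pi.sub_apply, h1, Finset.mul_sum, pull]
    simp only [← mul_assoc, ← ht, sub_mul, Finset.sum_sub_distrib]
    ring
  have hdvd : ∀ v, (m : ℤ) ∣ (k + β - γ) v := by
    intro v
    obtain ⟨τ, x, rfl⟩ := T.exists_vert_eq n v
    exact (dvd_sub_left (dvd_mul_right _ _)).1 ((dvd_mul_right _ _).trans (hlin τ x))
  choose l hl using hdvd
  have hm0 : (m : ℤ) ≠ 0 := by exact_mod_cast hm
  refine ⟨l, T.mem_balanced_iff.2 ⟨t, fun τ x => ?_⟩, γ - β, AddSubgroup.sub_mem _ hγ hβ, ?_⟩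
  · have h1 := hlin τ x
    rw [hl, ← mul_sub, mul_dvd_mul_iff_left hm0] at h1
    exact h1
  · funext v
    have h1 := hl v
    have h2 : (m • l) v = m * l v := by rw [Pi.smul_apply, nsmul_eq_mul]
    simp only [Pi.add_apply, Pi.sub_apply, h2] at h1 ⊢
    linarith

end IdealTriangulation

/-! ### The lattice identity and the center -/

namespace IdealTriangulation

variable {S : Type*} [TopologicalSpace S] {F : Type*} [Fintype F] (T : IdealTriangulation S F)
  {n : ℕ}

theorem doubledQ_swap (u v : T.SmallVertex n) : T.doubledQ n v u = -T.doubledQ n u v := by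
  classical
  simp only [doubledQ, ← Finset.sum_neg_distrib]
  refine Finset.sum_congr rfl fun τ _ => ?_
  rw [Finset.sum_comm]
  refine Finset.sum_congr rfl fun x _ => Finset.sum_congr rfl fun y _ => ?_
  by_cases h1 : T.vert n τ x = u <;> by_cases h2 : T.vert n τ y = v <;>
    simp [h1, h2, TriVertex.doubledQ]

variable {T}

theorem dvd_doubledForm {k : T.SmallVertex n → ℤ} {M : ℤ} (hk : ∀ v, M ∣ T.flux k v)
    (t : T.SmallVertex n → ℤ) : M ∣ T.doubledForm n k t := by
  rw [doubledForm_eq]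
  exact Finset.dvd_sum fun v _ => (hk v).mul_right _

theorem doubledForm_nsmul (m : ℕ) (k t : T.SmallVertex n → ℤ) :
    T.doubledForm n (m • k) t = m * T.doubledForm n k t := by
  simp only [doubledForm_eq, flux_nsmul, Finset.mul_sum, mul_assoc]

theorem doubledForm_add (k l t : T.SmallVertex n → ℤ) :
    T.doubledForm n (k + l) t = T.doubledForm n k t + T.doubledForm n l t := by
  simp only [doubledForm_eq, flux_add, add_mul, Finset.sum_add_distrib]

theorem doubledForm_eq_zero {k : T.SmallVertex n → ℤ} (hk : ∀ v, T.flux k v = 0)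
    (t : T.SmallVertex n → ℤ) : T.doubledForm n k t = 0 := by
  simp only [doubledForm_eq, hk, zero_mul, Finset.sum_const_zero]

theorem punctureSpan_le_balancedRadical : T.punctureSpan n ≤ T.balancedRadical n := fun _ hk =>
  ⟨T.punctureSpan_le_balanced hk, T.flux_eq_zero_of_mem_punctureSpan hk⟩

theorem single_mem_balanced [DecidableEq (T.SmallVertex n)] (v : T.SmallVertex n) :
    (Pi.single v (n : ℤ) : T.SmallVertex n → ℤ) ∈ T.balanced n := by
  refine fun τ => mem_balancedTriangle_iff.2 ⟨0, fun x => ?_⟩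
  rw [Pi.single_apply]
  split_ifs <;> simp

/-- The flux of a balanced vector `k` is `2 n r`. As `n` times a unit vector is balanced, the condition
that `k Q_λ tᵀ` is divisible by `g N d` for all balanced `t` implies that `g N d` divides `n ^ 2 r`,
whence `N` divides `r` by the coprimality assumptions. -/
theorem exists_of_mem_balancedModKernel {g N n₁ d e : ℕ} (hg : g ≠ 0) (hd : d ≠ 0) (hN : N ≠ 0)
    (hn : n = g * n₁) (hn' : n = d * e) (h₁ : IsCoprime ((N * d : ℕ) : ℤ) (n₁ : ℤ))
    (h₂ : IsCoprime (N : ℤ) (e : ℤ)) {k : T.SmallVertex n → ℤ}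
    (hk : k ∈ T.balancedModKernel n (g * (N * d))) :
    ∃ l ∈ T.balancedMod n d, ∃ β ∈ T.punctureSpan n, k = N • l + β := by
  classical
  have hg0 : (g : ℤ) ≠ 0 := by exact_mod_cast hg
  have hd0 : (d : ℤ) ≠ 0 := by exact_mod_cast hd
  have hN0 : (N : ℤ) ≠ 0 := by exact_mod_cast hN
  have hnZ : (n : ℤ) = g * n₁ := by exact_mod_cast hn
  have hnZ' : (n : ℤ) = d * e := by exact_mod_cast hn'
  have cancel : ∀ r : ℤ, 2 * ((g * (N * d) : ℕ) : ℤ) ∣ 2 * n * r → ((N * d : ℕ) : ℤ) ∣ r := by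
    intro r hr
    rw [mul_assoc, mul_dvd_mul_iff_left two_ne_zero, hnZ, Nat.cast_mul, mul_assoc,
      mul_dvd_mul_iff_left hg0] at hr
    exact h₁.dvd_of_dvd_mul_left hr
  have hflux : ∀ v, 2 * ((n : ℤ) * N) ∣ T.flux k v := by
    intro v
    obtain ⟨r, hr⟩ := dvd_flux_of_mem_balanced hk.1 v
    have h3 := hk.2 _ (single_mem_balanced v)
    have h4 : T.doubledForm n k (Pi.single v (n : ℤ)) = 2 * n * (n * r) := by
      rw [doubledForm_eq, Finset.sum_eq_single v, Pi.single_eq_same, hr]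
      · ring
      · intro w _ hw
        rw [Pi.single_eq_of_ne hw, mul_zero]
      · exact fun h => absurd (Finset.mem_univ _) h
    rw [h4] at h3
    have h5 := cancel _ h3
    rw [hnZ', Nat.cast_mul, mul_comm (N : ℤ), mul_assoc, mul_dvd_mul_iff_left hd0] at h5
    obtain ⟨q, rfl⟩ := h₂.dvd_of_dvd_mul_left h5
    exact ⟨q, by rw [hr]; ring⟩
  obtain ⟨l, hl, β, hβ, rfl⟩ := exists_eq_nsmul_add hN hk.1 hflux
  refine ⟨l, ⟨hl, fun t ht => ?_⟩, β, hβ, rfl⟩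
  obtain ⟨r, hr⟩ := dvd_doubledForm (dvd_flux_of_mem_balanced hl) t
  have h3 := hk.2 t ht
  rw [doubledForm_add, doubledForm_nsmul,
    doubledForm_eq_zero (T.flux_eq_zero_of_mem_punctureSpan hβ), add_zero, hr,
    show (N : ℤ) * (2 * n * r) = 2 * n * (N * r) by ring] at h3
  have h4 := cancel _ h3
  rw [Nat.cast_mul, mul_dvd_mul_iff_left hN0] at h4
  obtain ⟨q, rfl⟩ := h4
  exact ⟨q, by rw [hr]; push_cast; ring⟩

theorem nsmul_mem_balancedModKernel {g N n₁ d : ℕ} (hn : n = g * n₁) {l : T.SmallVertex n → ℤ}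
    (hl : l ∈ T.balancedMod n d) : N • l ∈ T.balancedModKernel n (g * (N * d)) := by
  refine ⟨AddSubgroup.nsmul_mem _ hl.1 _, fun t ht => ?_⟩
  obtain ⟨r, hr⟩ := hl.2 t ht
  refine ⟨n₁ * r, ?_⟩
  have hnZ : (n : ℤ) = g * n₁ := by exact_mod_cast hn
  rw [doubledForm_nsmul, hr]
  push_cast
  rw [hnZ]
  ring

theorem balancedRadical_le_balancedModKernel (M : ℕ) :
    T.balancedRadical n ≤ T.balancedModKernel n M := fun k hk =>
  ⟨hk.1, fun t _ => by rw [doubledForm_eq_zero hk.2]; exact dvd_zero _⟩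

theorem zpow_eq_one_iff {h : ℂˣ} {k t : T.SmallVertex n → ℤ} (hk : k ∈ T.balanced n) :
    h ^ (2 * ∑ u, ∑ v, k u * T.doubledQ n u v * t v) = 1 ↔
      (2 * (orderOf ((h ^ 2) ^ 2) : ℤ)) ∣ T.doubledForm n k t := by
  obtain ⟨r, hr⟩ := dvd_doubledForm (dvd_flux_of_mem_balanced hk) t
  have h1 : ∑ u, ∑ v, k u * T.doubledQ n u v * t v = 2 * (n * r) := by
    rw [← mul_assoc]; exact hr
  have h2 : h ^ (2 * (2 * ((n : ℤ) * r))) = ((h ^ 2) ^ 2) ^ ((n : ℤ) * r) := by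
    rw [← pow_mul, ← zpow_natCast, ← zpow_mul]
    congr 1
    push_cast
    ring
  rw [h1, h2, hr, mul_assoc, mul_dvd_mul_iff_left two_ne_zero, orderOf_dvd_iff_zpow_eq_one]

end IdealTriangulation

end

theorem theorem4p6 {S : Type*} [TopologicalSpace S] {F : Type*} [Fintype F]
    (T : IdealTriangulation S F) (n : ℕ) (hn : 1 ≤ n)
    (h : ℂˣ) (hh : IsOfFinOrder h)
    (N₂ N₁ d N : ℕ) (hN₂ : N₂ = orderOf ((h ^ 2) ^ 2)) (hN₁ : N₁ = N₂ / Nat.gcd N₂ n)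
    (hd : d = Nat.gcd N₁ n) (hN : N = N₁ / d) :
    Subalgebra.center ℂ (T.balancedAlgebra n h) =
        Algebra.adjoin ℂ
          ({z | ∃ k : T.balanced n, (k : T.SmallVertex n → ℤ) ∈ T.balancedMod n d ∧
              z = T.Φ n h N (T.Z n (h ^ (N ^ 2)) k)} ∪
            {z | ∃ p ∈ T.punctures, ∃ i : ℕ, 1 ≤ i ∧ i ≤ n - 1 ∧
              z = T.Z n h ⟨T.b n p i, T.b_mem n p i⟩}) ∧
      T.balancedModKernel n N₂ =
        (T.balancedMod n d).map (nsmulAddMonoidHom N) ⊔ T.balancedRadical n := by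
  classical
  have hN₂pos : 0 < N₂ := by
    rw [hN₂]
    exact (hh.pow.pow).orderOf_pos
  -- `N₂ = g N d`, `n = g n₁ = d e` with the coprimality relations of the greatest common divisors
  obtain ⟨g, n₁, e, hg, hd0, hN0, hgN, hgn, hde, hc1, hc2⟩ : ∃ g n₁ e : ℕ, g ≠ 0 ∧ d ≠ 0 ∧ N ≠ 0 ∧
      N₂ = g * (N * d) ∧ n = g * n₁ ∧ n = d * e ∧ IsCoprime ((N * d : ℕ) : ℤ) (n₁ : ℤ) ∧
      IsCoprime (N : ℤ) (e : ℤ) := by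
    have hg : 0 < Nat.gcd N₂ n := Nat.gcd_pos_of_pos_left _ hN₂pos
    have hNd : N * d = N₁ := by rw [hN, hd]; exact Nat.div_mul_cancel (Nat.gcd_dvd_left _ _)
    have hgN : N₂ = Nat.gcd N₂ n * N₁ := by
      rw [hN₁]; exact (Nat.mul_div_cancel' (Nat.gcd_dvd_left _ _)).symm
    have hd0 : 0 < d := by rw [hd]; exact Nat.gcd_pos_of_pos_right _ hn
    refine ⟨Nat.gcd N₂ n, n / Nat.gcd N₂ n, n / d, hg.ne', hd0.ne', ?_, ?_, ?_, ?_, ?_, ?_⟩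
    · rintro rfl
      rw [zero_mul] at hNd
      rw [← hNd, mul_zero] at hgN
      omega
    · rw [hNd]; exact hgN
    · exact (Nat.mul_div_cancel' (Nat.gcd_dvd_right _ _)).symm
    · rw [hd]; exact (Nat.mul_div_cancel' (Nat.gcd_dvd_right _ _)).symm
    · rw [hNd, hN₁, Nat.isCoprime_iff_coprime]
      exact Nat.coprime_div_gcd_div_gcd hg
    · rw [Nat.isCoprime_iff_coprime, hN]
      rw [hd] at hd0 ⊢
      exact Nat.coprime_div_gcd_div_gcd hd0
  have key : ∀ k ∈ T.balancedModKernel n N₂, ∃ l ∈ T.balancedMod n d, ∃ β ∈ T.punctureSpan n,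
      k = N • l + β := fun k hk =>
    IdealTriangulation.exists_of_mem_balancedModKernel hg hd0 hN0 hgn hde hc1 hc2 (hgN ▸ hk)
  have hsmul : ∀ l ∈ T.balancedMod n d, N • l ∈ T.balancedModKernel n N₂ := fun l hl => by
    rw [hgN]
    exact IdealTriangulation.nsmul_mem_balancedModKernel hgn hl
  have hrad := IdealTriangulation.balancedRadical_le_balancedModKernel (T := T) (n := n) N₂
  have hA : ∀ v w : T.SmallVertex n, T.doubledQ n w v = -T.doubledQ n v w := T.doubledQ_swap
  have hcentral : ∀ k : T.balanced n, (k : T.SmallVertex n → ℤ) ∈ T.balancedModKernel n N₂ →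
      T.Z n h k ∈ Subalgebra.center ℂ (T.balancedAlgebra n h) := by
    intro k hk
    refine QTorus.mono_mem_center (T.doubledQ n) h hA k fun t ht => ?_
    rw [IdealTriangulation.zpow_eq_one_iff k.2, ← hN₂]
    exact hk.2 t ht
  refine ⟨le_antisymm ?_ ?_, le_antisymm ?_ ?_⟩
  · set R := Algebra.adjoin ℂ
          ({z | ∃ k : T.balanced n, (k : T.SmallVertex n → ℤ) ∈ T.balancedMod n d ∧
              z = T.Φ n h N (T.Z n (h ^ (N ^ 2)) k)} ∪
            {z | ∃ p ∈ T.punctures, ∃ i : ℕ, 1 ≤ i ∧ i ≤ n - 1 ∧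
              z = T.Z n h ⟨T.b n p i, T.b_mem n p i⟩}) with hR
    have hfrob : ∀ k : T.balanced n, (k : T.SmallVertex n → ℤ) ∈ T.balancedMod n d →
        T.Z n h (N • k) ∈ R := fun k hk =>
      Algebra.subset_adjoin (Or.inl ⟨k, hk, (QTorus.frobeniusMono_mono _ h _ N k).symm⟩)
    have hspan : ∀ β ∈ T.punctureSpan n, ∃ hβ : β ∈ T.balanced n, T.Z n h ⟨β, hβ⟩ ∈ R := by
      intro β hβ
      refine QTorus.exists_mono_mem_of_mem_closure h hA (T.balanced n) hN0 ?_ ?_ hβ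
      · rintro _ ⟨p, hp, i, h1, h2, rfl⟩
        exact ⟨T.b_mem n p i, Algebra.subset_adjoin (Or.inr ⟨p, hp, i, h1, h2, rfl⟩)⟩
      · intro x hx
        exact hfrob x (IdealTriangulation.balancedRadical_le_balancedModKernel _
          (IdealTriangulation.punctureSpan_le_balancedRadical hx))
    have hmem : ∀ k ∈ T.balancedModKernel n N₂,
        ∃ hk : k ∈ T.balanced n, T.Z n h ⟨k, hk⟩ ∈ R := by
      intro k hk
      obtain ⟨l, hl, β, hβ, rfl⟩ := key k hk
      obtain ⟨hβ', hβR⟩ := hspan β hβ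
      have h1 : (⟨N • l + β, hk.1⟩ : T.balanced n) = N • ⟨l, hl.1⟩ + ⟨β, hβ'⟩ :=
        Subtype.ext (by rw [AddSubgroup.coe_add, AddSubgroup.coe_nsmul])
      refine ⟨hk.1, ?_⟩
      rw [h1]
      exact QTorus.mono_add_mem h hA _ (hfrob ⟨l, hl.1⟩ hl) hβR
    intro z hz
    have h1 := QTorus.mem_span_of_mem_center h hA _ hz
    have h2 : (z : QTorus (T.doubledQ n) h) ∈
        (Subalgebra.toSubmodule R).map (T.balancedAlgebra n h).val.toLinearMap := by
      refine Submodule.span_le.2 ?_ h1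
      rintro _ ⟨k, ⟨hk, hk'⟩, rfl⟩
      obtain ⟨hk'', hkR⟩ := hmem k ⟨hk, fun t ht => by
        rw [hN₂]
        exact (IdealTriangulation.zpow_eq_one_iff hk).1 (hk' t ht)⟩
      exact ⟨_, hkR, rfl⟩
    obtain ⟨y, hy, hyz⟩ := h2
    rwa [← (Subtype.ext hyz : y = z)]
  · refine Algebra.adjoin_le ?_
    rintro _ (⟨k, hk, rfl⟩ | ⟨p, hp, i, h1, h2, rfl⟩)
    · show T.Φ n h N (T.Z n (h ^ (N ^ 2)) k) ∈ Subalgebra.center ℂ (T.balancedAlgebra n h)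
      rw [QTorus.frobeniusMono_mono]
      exact hcentral _ (hsmul _ hk)
    · exact hcentral _ (hrad (IdealTriangulation.punctureSpan_le_balancedRadical
        (AddSubgroup.subset_closure ⟨p, hp, i, h1, h2, rfl⟩)))
  · intro k hk
    obtain ⟨l, hl, β, hβ, rfl⟩ := key k hk
    exact AddSubgroup.add_mem_sup ⟨l, hl, rfl⟩
      (IdealTriangulation.punctureSpan_le_balancedRadical hβ)
  · refine sup_le ?_ hrad
    rintro _ ⟨l, hl, rfl⟩
    exact hsmul l hl
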